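/- **Theorem (Effect of the overestimation policy).** Users $1,\dots,U$ have preference vectors $\theta_u\in\mathbb R^d$ with $\|\theta_u\|_2\le 1$ and are partitioned into clusters, with $\theta_u=\theta_v$ if and only if $u$ and $v$ are in the same cluster. There are at least two nonempty clusters, and $\gamma>0$ satisfies $\|\theta_u-\theta_v\|_2\ge\gamma$ whenever $u,v$ are in different clusters. *Data.* Let $\rho$ be a probability distribution on the closed unit ball of $\mathbb R^d$ such that the minimum eigenvalue $\lambda_a$ of $\mathbb E_{a\sim\rho}[aa^\top]$ is positive and, for some $\sigma>0$ and every unit vector $x$, the variable $(x^\top a)^2$, $a\sim\rho$, is sub-Gaussian around its mean with variance proxy $\sigma^2$. User $u$ has $N_u\ge 1$ logged samples $(a_u^i,r_u^i)_{i\le N_u}$, generated sequentially: at sample $i$ at most $S$ candidate actions are drawn independently from $\rho$, independently of the past of user $u$; a logging policy selects $a_u^i$ among them in an arbitrary (history-dependent, possibly randomized) way; and, conditionally on the past, the candidates and $a_u^i$, the reward $r_u^i$ has mean $\langle\theta_u,a_u^i\rangle$ and $1$-sub-Gaussian noise. Put $\tilde\lambda_a=\int_0^{\lambda_a}\bigl(1-e^{-(\lambda_a-x)^2/(2\sigma^2)}\bigr)^S\,dx$.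 *Statistics.* For parameters $\alpha\ge1$, $\lambda>0$, $\delta>0$ let $M_u=\lambda I+\sum_i a_u^i(a_u^i)^\top$, $b_u=\sum_i r_u^ia_u^i$, $\hat\theta_u=M_u^{-1}b_u$, $$\mathrm{CI}_u=\frac{\sqrt{d\log\bigl(1+\frac{N_u}{\lambda d}\bigr)+2\log\frac{2U}{\delta}}+\sqrt\lambda}{\sqrt{\tilde\lambda_aN_u/2}},$$ $$\Gamma(u,v)=\|\hat\theta_u-\hat\theta_v\|_2-\alpha(\mathrm{CI}_u+\mathrm{CI}_v),\qquad \tilde\Gamma(u,v)=\|\hat\theta_u-\hat\theta_v\|_2+\alpha(\mathrm{CI}_u+\mathrm{CI}_v),$$ and $M(u)=\{v\ne u:\Gamma(u,v)>0\}$. For a test user $u_{\rm test}$ let $\hat\gamma=\min_{v\in M(u_{\rm test})}\tilde\Gamma(u_{\rm test},v)$ if $M(u_{\rm test})\neq\emptyset$, and $\hat\gamma=0$ otherwise. Then, with probability at least $1-\tfrac32\delta$, the following holds: if $M(u_{\rm test})\ne\emptyset$, then $\hat\gamma\ge\gamma$. (For $\delta\ge 2/3$ the bound is trivial.) -/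

import Mathlib

open MeasureTheory ProbabilityTheory
open scoped NNReal RealInnerProductSpace

noncomputable section

namespace OffClusBand

/-- Actions and preference vectors: `ℝ^d` with the Euclidean norm. -/
abbrev Vec (d : ℕ) : Type := EuclideanSpace ℝ (Fin d)

/-- The second moment matrix `E_{a ∼ ρ}[a aᵀ]`. -/
def secondMoment {d : ℕ} (ρ : Measure (Vec d)) : Matrix (Fin d) (Fin d) ℝ :=
  Matrix.of fun i j => ∫ a, a i * a j ∂ρ

/-- Regularity of the action distribution `ρ`: it is carried by the closed unit ball, the minimum
eigenvalue `lamA` of `E[a aᵀ]` is positive, and for every unit vector `x` the random variable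
`(xᵀ a)²` is sub-Gaussian (around its mean) with variance proxy `σ²`. -/
structure RegularActionLaw {d : ℕ} (ρ : Measure (Vec d)) (lamA : ℝ) (σ : ℝ≥0) : Prop where
  prob : IsProbabilityMeasure ρ
  norm_le_one : ∀ᵐ a ∂ρ, ‖a‖ ≤ 1
  isLeast_eigenvalue : IsLeast (spectrum ℝ (secondMoment ρ)) lamA
  lamA_pos : 0 < lamA
  sigma_pos : 0 < σ
  subgaussian : ∀ x : Vec d, ‖x‖ = 1 →
    HasSubgaussianMGF (fun a => ⟪x, a⟫ ^ 2 - ∫ b, ⟪x, b⟫ ^ 2 ∂ρ) (σ ^ 2) ρ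

/-- The smoothed regularity parameter
`∫₀^{lamA} (1 - exp (-(lamA - x)² / (2 σ²)))^S dx`. -/
def smoothedRegularity (lamA : ℝ) (σ : ℝ≥0) (S : ℕ) : ℝ :=
  ∫ x in (0 : ℝ)..lamA, (1 - Real.exp (-(lamA - x) ^ 2 / (2 * (σ : ℝ) ^ 2))) ^ S

/-- A (random) offline dataset for `U` users: user `u` has `N u` samples, numbered `i < N u`; the
`i`-th sample consists of a finite list of candidate actions, the logged action and its reward.
Entries with `i ≥ N u` are never used. -/
structure OfflineData (Ω : Type*) (U d : ℕ) where
  /-- number of samples of each user -/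
  N : Fin U → ℕ
  /-- number of candidate actions at each sample -/
  numCand : Fin U → ℕ → ℕ
  /-- the candidate actions -/
  cand : (u : Fin U) → (i : ℕ) → Fin (numCand u i) → Ω → Vec d
  /-- the logged action -/
  action : Fin U → ℕ → Ω → Vec d
  /-- the logged reward -/
  reward : Fin U → ℕ → Ω → ℝ

/-- The noise of a reward: its deviation from the linear mean `⟨θ_u, a_u^i⟩`. -/
def noise {Ω : Type*} {U d : ℕ} (D : OfflineData Ω U d) (θ : Fin U → Vec d) (u : Fin U) (i : ℕ)
    (ω : Ω) : ℝ :=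
  D.reward u i ω - ⟪θ u, D.action u i ω⟫

/-- What is known just before the `i`-th reward of user `u` is drawn: the past, the `i`-th
candidates and the `i`-th action. -/
abbrev preReward {Ω : Type*} {mΩ : MeasurableSpace Ω} {U d : ℕ} (D : OfflineData Ω U d)
    (past : (u : Fin U) → Filtration ℕ mΩ) (u : Fin U) (i : ℕ) : MeasurableSpace Ω :=
  past u i ⊔ (⨆ j, MeasurableSpace.comap (D.cand u i j) inferInstance)
    ⊔ MeasurableSpace.comap (D.action u i) inferInstance

/-- The data-generating process. `past u i` is the information available before the `i`-th sample
of user `u`. At each sample at most `S` candidates are drawn independently from `ρ`, independently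
of the past; the logging policy selects one of them in an arbitrary (history dependent, possibly
randomized) way; and the reward has conditional mean `⟨θ_u, a_u^i⟩` with conditionally
`1`-sub-Gaussian noise. Nothing is required about the joint law of different users' data. -/
structure IsOffClusBand {Ω : Type*} {mΩ : MeasurableSpace Ω} {U d : ℕ} (μ : Measure Ω)
    (D : OfflineData Ω U d) (θ : Fin U → Vec d) (ρ : Measure (Vec d)) (S : ℕ)
    (past : (u : Fin U) → Filtration ℕ mΩ) : Prop where
  numCand_le : ∀ u, ∀ i < D.N u, D.numCand u i ≤ S
  measurable_cand : ∀ u, ∀ i < D.N u, ∀ j, Measurable[past u (i + 1)] (D.cand u i j)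
  measurable_action : ∀ u, ∀ i < D.N u, Measurable[past u (i + 1)] (D.action u i)
  measurable_reward : ∀ u, ∀ i < D.N u, Measurable[past u (i + 1)] (D.reward u i)
  cand_law : ∀ u, ∀ i < D.N u, ∀ j, μ.map (D.cand u i j) = ρ
  cand_iIndep : ∀ u, ∀ i < D.N u, iIndepFun (D.cand u i) μ
  cand_indep_past : ∀ u, ∀ i < D.N u,
    Indep (⨆ j, MeasurableSpace.comap (D.cand u i j) inferInstance) (past u i) μ
  action_mem : ∀ u, ∀ i < D.N u, ∀ᵐ ω ∂μ, ∃ j, D.action u i ω = D.cand u i j ω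
  reward_mean : ∀ u, ∀ i < D.N u,
    μ[D.reward u i | preReward D past u i] =ᵐ[μ] fun ω => ⟪θ u, D.action u i ω⟫
  integrable_exp_noise : ∀ u, ∀ i < D.N u, ∀ t : ℝ,
    Integrable (fun ω => Real.exp (t * noise D θ u i ω)) μ
  noise_subgaussian : ∀ u, ∀ i < D.N u, ∀ t : ℝ,
    μ[fun ω => Real.exp (t * noise D θ u i ω) | preReward D past u i]
      ≤ᵐ[μ] fun _ => Real.exp (t ^ 2 / 2)

section Statistics

variable {Ω : Type*} {U d : ℕ}

/-- `M_u = lam I + ∑_{i} a_u^i (a_u^i)ᵀ`. -/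
def gram (D : OfflineData Ω U d) (lam : ℝ) (u : Fin U) (ω : Ω) : Matrix (Fin d) (Fin d) ℝ :=
  lam • (1 : Matrix (Fin d) (Fin d) ℝ) +
    ∑ i ∈ Finset.range (D.N u), Matrix.vecMulVec (D.action u i ω).ofLp (D.action u i ω).ofLp

/-- `b_u = ∑_{i} r_u^i a_u^i`. -/
def moment (D : OfflineData Ω U d) (u : Fin U) (ω : Ω) : Vec d :=
  ∑ i ∈ Finset.range (D.N u), D.reward u i ω • D.action u i ω

/-- The ridge estimate `M_u⁻¹ b_u`. -/
def ridge (D : OfflineData Ω U d) (lam : ℝ) (u : Fin U) (ω : Ω) : Vec d :=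
  WithLp.toLp 2 ((gram D lam u ω)⁻¹.mulVec (moment D u ω).ofLp)

/-- The confidence width `CI_u`; `lamT` is the smoothed regularity parameter. -/
def confWidth (D : OfflineData Ω U d) (lam lamT δ : ℝ) (u : Fin U) : ℝ :=
  (√(d * Real.log (1 + D.N u / (lam * d)) + 2 * Real.log (2 * U / δ)) + √lam) /
    √(lamT * D.N u / 2)

/-- The lower statistic `Γ(u, v)`. -/
def lowerGap (D : OfflineData Ω U d) (lam lamT δ α : ℝ) (u v : Fin U) (ω : Ω) : ℝ :=
  ‖ridge D lam u ω - ridge D lam v ω‖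
    - α * (confWidth D lam lamT δ u + confWidth D lam lamT δ v)

/-- The upper statistic `Γ̃(u, v)`. -/
def upperGap (D : OfflineData Ω U d) (lam lamT δ α : ℝ) (u v : Fin U) (ω : Ω) : ℝ :=
  ‖ridge D lam u ω - ridge D lam v ω‖
    + α * (confWidth D lam lamT δ u + confWidth D lam lamT δ v)

open scoped Classical in
/-- `M(u) = {v ≠ u | Γ(u, v) > 0}`. -/
def certified (D : OfflineData Ω U d) (lam lamT δ α : ℝ) (u : Fin U) (ω : Ω) : Finset (Fin U) :=
  Finset.univ.filter fun v => v ≠ u ∧ 0 < lowerGap D lam lamT δ α u v ω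

open scoped Classical in
/-- The overestimation policy: the minimum of `Γ̃(u, ·)` over `M(u)`, and `0` if `M(u) = ∅`. -/
def gammaHatOver (D : OfflineData Ω U d) (lam lamT δ α : ℝ) (u : Fin U) (ω : Ω) : ℝ :=
  if h : (certified D lam lamT δ α u ω).Nonempty then
    (certified D lam lamT δ α u ω).inf' h fun v => upperGap D lam lamT δ α u v ω
  else 0

end Statistics

end OffClusBand

end

noncomputable section

namespace OffClusBand

open Filter Topology
open scoped ENNReal

/-! ### Conditional sub-Gaussian bounds with predictable multipliers. -/

section Conditional

variable {Ω : Type*} {m mΩ : MeasurableSpace Ω} {μ : Measure Ω}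

/-! If some certified `v` has `upperGap` below `γ`, then `γ ≤ 2` and `lowerGap > 0` force both
confidence widths to be at most 1, and the triangle inequality makes one of the two ridge estimates
miss its confidence ball (`exists_confWidth_lt`). So it suffices to validate widths of size at most
1, and a union bound over users finishes.

No separate eigenvalue concentration is used: a single exponential process controls noise and design
together. In `∑ (⟨y,a_i⟩η_i - ⟨y,a_i⟩²)` half of each square pays for the noise. The other half,
bounded below by the worst candidate, gives a factor `exp(-(1 - exp(-‖y‖²/2)) * lamT)` per sample,
with `lamT` the smoothed regularity (`lintegral_exp_selfNormExponent_le`). After multiplication by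
the inverse factors, integration against a Gaussian of precision `lam` gives a mixture of mean at
most the Gaussian mass.

When the estimate misses its ball, the exponent is large at the point `y` of norm `confWidth` in the
direction of the error. Jensen's inequality for a narrower Gaussian centred at `y` makes the whole
mixture at least `2U/δ` times the Gaussian mass (`le_lintegral_exp_weightedExponent`), and Markov's
inequality concludes. -/

theorem lintegral_mul_ofReal_le_of_condExp_le [IsFiniteMeasure μ] (hm : m ≤ mΩ) {f : Ω → ℝ}
    (hf : Integrable f μ) (hf0 : 0 ≤ f) {c : ℝ} (hc : μ[f | m] ≤ᵐ[μ] fun _ => c)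
    {X : Ω → ℝ≥0∞} (hX : Measurable[m] X) :
    ∫⁻ ω, X ω * ENNReal.ofReal (f ω) ∂μ ≤ ENNReal.ofReal c * ∫⁻ ω, X ω ∂μ := by
  have hfm : AEMeasurable (fun ω => ENNReal.ofReal (f ω)) μ := hf.aemeasurable.ennreal_ofReal
  -- Comparing measures on `m` avoids any integrability requirement on `X`.
  have hle : (μ.withDensity fun ω => ENNReal.ofReal (f ω)).trim hm
      ≤ ENNReal.ofReal c • μ.trim hm := by
    refine Measure.le_iff.2 fun A hA => ?_
    rw [trim_measurableSet_eq hm hA, Measure.smul_apply, trim_measurableSet_eq hm hA,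
      withDensity_apply _ (hm A hA),
      ← ofReal_integral_eq_lintegral_ofReal hf.integrableOn (ae_of_all _ hf0),
      ← setIntegral_condExp hm hf hA, smul_eq_mul]
    have h1 : ∫ ω in A, (μ[f | m]) ω ∂μ ≤ ∫ _ in A, c ∂μ :=
      integral_mono_ae integrable_condExp.integrableOn (integrable_const c)
        (ae_restrict_of_ae hc)
    rw [setIntegral_const, smul_eq_mul] at h1
    rcases le_or_gt 0 c with h0 | h0
    · refine (ENNReal.ofReal_le_ofReal h1).trans ?_
      rw [ENNReal.ofReal_mul measureReal_nonneg, mul_comm, Measure.real,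
        ENNReal.ofReal_toReal (measure_ne_top _ _)]
    · rw [ENNReal.ofReal_of_nonpos (h1.trans
        (mul_nonpos_of_nonneg_of_nonpos measureReal_nonneg h0.le))]
      exact zero_le
  calc ∫⁻ ω, X ω * ENNReal.ofReal (f ω) ∂μ
      = ∫⁻ ω, X ω ∂(μ.withDensity fun ω => ENNReal.ofReal (f ω)) := by
        rw [lintegral_withDensity_eq_lintegral_mul₀ hfm (hX.mono hm le_rfl).aemeasurable]
        simp [mul_comm]
    _ = ∫⁻ ω, X ω ∂((μ.withDensity fun ω => ENNReal.ofReal (f ω)).trim hm) :=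
        (lintegral_trim hm hX).symm
    _ ≤ ∫⁻ ω, X ω ∂(ENNReal.ofReal c • μ.trim hm) := lintegral_mono' hle le_rfl
    _ = ENNReal.ofReal c * ∫⁻ ω, X ω ∂μ := by
        rw [lintegral_smul_measure, lintegral_trim hm hX, smul_eq_mul]

variable [IsFiniteMeasure μ] (hm : m ≤ mΩ) {η : Ω → ℝ} (hη : Measurable η)
  (hint : ∀ t : ℝ, Integrable (fun ω => Real.exp (t * η ω)) μ)
  (hsub : ∀ t : ℝ, μ[fun ω => Real.exp (t * η ω) | m] ≤ᵐ[μ] fun _ => Real.exp (t ^ 2 / 2))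

include hm hη hint hsub

/-- On each level set of `g` the multiplier is a constant `t`, where the conditional bound applies;
the level sets lie in `m`, so their indicators can be absorbed into `X`. -/
theorem lintegral_mul_exp_finite_range_le {g : Ω → ℝ} (hg : Measurable[m] g)
    (hfin : (Set.range g).Finite) {X : Ω → ℝ≥0∞} (hX : Measurable[m] X) :
    ∫⁻ ω, X ω * ENNReal.ofReal (Real.exp (g ω * η ω - g ω ^ 2 / 2)) ∂μ ≤ ∫⁻ ω, X ω ∂μ := by
  classical
  have hXi : ∀ t, Measurable[m] ((g ⁻¹' {t}).indicator X) := fun t =>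
    Measurable.indicator (m := m) hX (hg (measurableSet_singleton t))
  have hmem : ∀ ω, g ω ∈ hfin.toFinset := fun ω => by simp
  have hsplit : ∀ F : Ω → ℝ≥0∞, ∀ ω, X ω * F ω
      = ∑ t ∈ hfin.toFinset, (g ⁻¹' {t}).indicator X ω * F ω := by
    intro F ω
    rw [Finset.sum_eq_single (g ω)]
    · simp
    · intro t _ ht
      rw [Set.indicator_of_notMem (by simpa using ht.symm), zero_mul]
    · intro h; exact absurd (hmem ω) h
  have hmeas : ∀ t, Measurable fun ω => (g ⁻¹' {t}).indicator X ω := fun t =>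
    (hXi t).mono hm le_rfl
  calc ∫⁻ ω, X ω * ENNReal.ofReal (Real.exp (g ω * η ω - g ω ^ 2 / 2)) ∂μ
      = ∫⁻ ω, ∑ t ∈ hfin.toFinset, ENNReal.ofReal (Real.exp (-(t ^ 2 / 2))) *
          ((g ⁻¹' {t}).indicator X ω * ENNReal.ofReal (Real.exp (t * η ω))) ∂μ := by
        refine lintegral_congr fun ω => ?_
        refine (hsplit (fun ω => ENNReal.ofReal (Real.exp (g ω * η ω - g ω ^ 2 / 2))) ω).trans ?_
        refine Finset.sum_congr rfl fun t _ => ?_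
        by_cases h : g ω = t
        · subst h
          rw [sub_eq_add_neg, Real.exp_add, ENNReal.ofReal_mul (Real.exp_pos _).le]
          ring
        · rw [Set.indicator_of_notMem (by simpa using h)]; simp
    _ = ∑ t ∈ hfin.toFinset, ENNReal.ofReal (Real.exp (-(t ^ 2 / 2))) *
          ∫⁻ ω, (g ⁻¹' {t}).indicator X ω * ENNReal.ofReal (Real.exp (t * η ω)) ∂μ := by
        rw [lintegral_finsetSum]
        · refine Finset.sum_congr rfl fun t _ => ?_
          rw [lintegral_const_mul]
          exact (hmeas t).mul (by fun_prop)
        · exact fun t _ => ((hmeas t).mul (by fun_prop)).const_mul _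
    _ ≤ ∑ t ∈ hfin.toFinset, ∫⁻ ω, (g ⁻¹' {t}).indicator X ω ∂μ := by
        refine Finset.sum_le_sum fun t _ => ?_
        have h := lintegral_mul_ofReal_le_of_condExp_le hm (hint t)
          (fun ω => (Real.exp_pos _).le) (hsub t) (hXi t)
        calc _ ≤ ENNReal.ofReal (Real.exp (-(t ^ 2 / 2))) *
              (ENNReal.ofReal (Real.exp (t ^ 2 / 2)) *
                ∫⁻ ω, (g ⁻¹' {t}).indicator X ω ∂μ) := by gcongr
          _ = _ := by
            rw [← mul_assoc, ← ENNReal.ofReal_mul (Real.exp_pos _).le, ← Real.exp_add]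
            simp
    _ = ∫⁻ ω, X ω ∂μ := by
        rw [← lintegral_finsetSum _ fun t _ => hmeas t]
        refine lintegral_congr fun ω => ?_
        simpa using (hsplit (fun _ => 1) ω).symm

/-- A conditionally `1`-sub-Gaussian variable multiplied by a random factor known beforehand. -/
theorem lintegral_mul_exp_measurable_le {T : Ω → ℝ} (hT : Measurable[m] T)
    {X : Ω → ℝ≥0∞} (hX : Measurable[m] X) :
    ∫⁻ ω, X ω * ENNReal.ofReal (Real.exp (T ω * η ω - T ω ^ 2 / 2)) ∂μ ≤ ∫⁻ ω, X ω ∂μ := by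
  have hTs : StronglyMeasurable[m] T := hT.stronglyMeasurable
  set g : ℕ → @SimpleFunc Ω m ℝ := hTs.approx with hg
  have hlim : ∀ ω, Tendsto (fun k => g k ω) atTop (𝓝 (T ω)) := hTs.tendsto_approx
  have hgm' : ∀ k, Measurable[m] fun ω => g k ω := fun k => @SimpleFunc.measurable _ _ m _ (g k)
  have hgm : ∀ k, Measurable fun ω => g k ω := fun k => (hgm' k).mono hm le_rfl
  have hXm : Measurable X := hX.mono hm le_rfl
  calc ∫⁻ ω, X ω * ENNReal.ofReal (Real.exp (T ω * η ω - T ω ^ 2 / 2)) ∂μ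
      = ∫⁻ ω, liminf (fun k => X ω *
          ENNReal.ofReal (Real.exp (g k ω * η ω - g k ω ^ 2 / 2))) atTop ∂μ := by
        refine lintegral_congr fun ω => (Tendsto.liminf_eq ?_).symm
        refine ENNReal.Tendsto.const_mul (ENNReal.tendsto_ofReal ?_)
          (Or.inl (by simpa using Real.exp_pos _))
        have := hlim ω
        exact (Real.continuous_exp.tendsto _).comp
          ((this.mul_const _).sub ((this.pow 2).div_const 2))
    -- Fatou's lemma carries the bound from simple multipliers to the limit.
    _ ≤ liminf (fun k => ∫⁻ ω, X ω *
          ENNReal.ofReal (Real.exp (g k ω * η ω - g k ω ^ 2 / 2)) ∂μ) atTop := by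
        refine lintegral_liminf_le fun k => hXm.mul ?_
        have := hgm k
        fun_prop
    _ ≤ ∫⁻ ω, X ω ∂μ := by
        refine liminf_le_of_le ?_ fun b hb => ?_
        · isBoundedDefault
        · obtain ⟨k, hk⟩ := hb.exists
          exact hk.trans (lintegral_mul_exp_finite_range_le hm hη hint hsub (hgm' k)
            (@SimpleFunc.finite_range _ _ m (g k)) hX)

end Conditional

/-! ### Consequences of the regularity of the action law. -/

section ActionLaw

variable {d : ℕ} {ρ : Measure (Vec d)} {lamA : ℝ} {σ : ℝ≥0}

theorem abs_apply_le_norm (a : Vec d) (i : Fin d) : |a i| ≤ ‖a‖ :=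
  PiLp.norm_apply_le a i

theorem RegularActionLaw.integrable_apply_mul (hρ : RegularActionLaw ρ lamA σ) (i j : Fin d) :
    Integrable (fun a : Vec d => a i * a j) ρ := by
  have := hρ.prob
  refine Integrable.of_bound (C := 1) (by fun_prop) ?_
  filter_upwards [hρ.norm_le_one] with a ha
  rw [Real.norm_eq_abs, abs_mul]
  exact mul_le_one₀ ((abs_apply_le_norm a i).trans ha) (abs_nonneg _)
    ((abs_apply_le_norm a j).trans ha)

theorem RegularActionLaw.integral_inner_sq (hρ : RegularActionLaw ρ lamA σ) (x : Vec d) :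
    ∫ a, ⟪x, a⟫ ^ 2 ∂ρ = x.ofLp ⬝ᵥ (secondMoment ρ).mulVec x.ofLp := by
  have h : ∀ a : Vec d, ⟪x, a⟫ ^ 2 = ∑ i, ∑ j, x i * x j * (a i * a j) := by
    intro a
    rw [PiLp.inner_apply, sq, Finset.sum_mul_sum]
    refine Finset.sum_congr rfl fun i _ => Finset.sum_congr rfl fun j _ => ?_
    simp only [RCLike.inner_apply, conj_trivial]
    ring
  simp only [h]
  rw [integral_finsetSum _ fun i _ => integrable_finsetSum _ fun j _ =>
    (hρ.integrable_apply_mul i j).const_mul _]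
  simp only [dotProduct, Matrix.mulVec, secondMoment, Matrix.of_apply, Finset.mul_sum]
  refine Finset.sum_congr rfl fun i _ => ?_
  rw [integral_finsetSum _ fun j _ => (hρ.integrable_apply_mul i j).const_mul _]
  refine Finset.sum_congr rfl fun j _ => ?_
  rw [integral_const_mul]
  ring

theorem RegularActionLaw.le_integral_inner_sq (hρ : RegularActionLaw ρ lamA σ) (x : Vec d) :
    lamA * ‖x‖ ^ 2 ≤ ∫ a, ⟪x, a⟫ ^ 2 ∂ρ := by
  have hherm : (secondMoment ρ - algebraMap ℝ (Matrix (Fin d) (Fin d) ℝ) lamA).IsHermitian := by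
    refine Matrix.IsHermitian.sub ?_ ?_
    · ext i j
      simp [secondMoment, mul_comm]
    · rw [Algebra.algebraMap_eq_smul_one]
      ext i j
      simp [Matrix.one_apply, eq_comm]
  have hpsd : (secondMoment ρ - algebraMap ℝ (Matrix (Fin d) (Fin d) ℝ) lamA).PosSemidef := by
    refine Matrix.posSemidef_iff_isHermitian_and_spectrum_nonneg.2 ⟨hherm, fun t ht => ?_⟩
    rw [← spectrum.sub_singleton_eq] at ht
    obtain ⟨s, hs, l, hl, rfl⟩ := ht
    have := hρ.isLeast_eigenvalue.2 hs
    simp only [Set.mem_singleton_iff] at hl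
    subst hl
    simpa using this
  have h := hpsd.dotProduct_mulVec_nonneg x.ofLp
  rw [hρ.integral_inner_sq, EuclideanSpace.real_norm_sq_eq]
  simp only [star_trivial, Matrix.sub_mulVec, dotProduct_sub, Algebra.algebraMap_eq_smul_one,
    Matrix.smul_mulVec, Matrix.one_mulVec, dotProduct_smul, smul_eq_mul] at h
  have : x.ofLp ⬝ᵥ x.ofLp = ∑ i, x i ^ 2 := by simp [dotProduct, sq]
  rw [this] at h
  linarith

/-- The trace of the second moment matrix is `E‖a‖² ≤ 1` and each diagonal entry is at least `lamA`.
-/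
theorem RegularActionLaw.mul_le_one (hρ : RegularActionLaw ρ lamA σ) : d * lamA ≤ 1 := by
  have := hρ.prob
  have hi : ∀ i : Fin d, lamA ≤ ∫ a, a i * a i ∂ρ := fun i => by
    have h := hρ.le_integral_inner_sq (EuclideanSpace.single i 1)
    simpa [EuclideanSpace.inner_single_left, sq] using h
  calc d * lamA = ∑ _i : Fin d, lamA := by simp
    _ ≤ ∑ i : Fin d, ∫ a, a i * a i ∂ρ := Finset.sum_le_sum fun i _ => hi i
    _ = ∫ a, ∑ i : Fin d, a i * a i ∂ρ :=
        (integral_finsetSum _ fun i _ => hρ.integrable_apply_mul i i).symm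
    _ ≤ ∫ _, (1 : ℝ) ∂ρ := by
        refine integral_mono_ae (integrable_finsetSum _ fun i _ => hρ.integrable_apply_mul i i)
          (integrable_const _) ?_
        filter_upwards [hρ.norm_le_one] with a ha
        have : ∑ i : Fin d, a i * a i = ‖a‖ ^ 2 := by
          rw [EuclideanSpace.real_norm_sq_eq]; simp [sq]
        simp only [this]
        exact pow_le_one₀ (norm_nonneg _) ha
    _ = 1 := by simp

/-- Lower sub-Gaussian tail of `⟨x,a⟩²`, whose mean is at least `lamA`. -/
theorem RegularActionLaw.one_sub_exp_le (hρ : RegularActionLaw ρ lamA σ) {x : Vec d}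
    (hx : ‖x‖ = 1) {z : ℝ} (hz : z ≤ lamA) :
    1 - Real.exp (-(lamA - z) ^ 2 / (2 * (σ : ℝ) ^ 2)) ≤ ρ.real {a | z < ⟪x, a⟫ ^ 2} := by
  have := hρ.prob
  have hmean : lamA ≤ ∫ b, ⟪x, b⟫ ^ 2 ∂ρ := by simpa [hx] using hρ.le_integral_inner_sq x
  set c := ∫ b, ⟪x, b⟫ ^ 2 ∂ρ with hc
  have h := (hρ.subgaussian x hx).neg.measure_ge_le (sub_nonneg.2 (hz.trans hmean))
  have hset : {a : Vec d | z < ⟪x, a⟫ ^ 2} =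
      {a | c - z ≤ (-fun a => ⟪x, a⟫ ^ 2 - c) a}ᶜ := by
    ext a
    simp only [Set.mem_ofPred_eq, Set.mem_compl_iff, Pi.neg_apply, not_le]
    constructor <;> intro h <;> linarith
  have hm : MeasurableSet {a : Vec d | c - z ≤ (-fun a => ⟪x, a⟫ ^ 2 - c) a} := by
    refine measurableSet_le measurable_const ?_
    simp only [Pi.neg_def]
    fun_prop
  rw [hset, probReal_compl_eq_one_sub hm]
  refine sub_le_sub_left (h.trans (Real.exp_le_exp.2 ?_)) _
  have : (0 : ℝ) < σ := hρ.sigma_pos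
  rw [NNReal.coe_pow]
  refine div_le_div_of_nonneg_right (neg_le_neg ?_) (by positivity)
  exact pow_le_pow_left₀ (sub_nonneg.2 hz) (by linarith) 2

theorem one_sub_exp_nonneg (t s : ℝ) : 0 ≤ 1 - Real.exp (-t ^ 2 / (2 * s ^ 2)) := by
  rw [sub_nonneg, Real.exp_le_one_iff, neg_div]
  exact neg_nonpos.2 (by positivity)

theorem one_sub_exp_le_one (t : ℝ) : 1 - Real.exp t ≤ 1 := by
  linarith [Real.exp_pos t]

theorem continuous_smoothedRegularity_integrand (lamA : ℝ) (σ : ℝ≥0) (S : ℕ) :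
    Continuous fun x : ℝ => (1 - Real.exp (-(lamA - x) ^ 2 / (2 * (σ : ℝ) ^ 2))) ^ S := by
  fun_prop

theorem RegularActionLaw.smoothedRegularity_pos (hρ : RegularActionLaw ρ lamA σ) (S : ℕ) :
    0 < smoothedRegularity lamA σ S := by
  refine intervalIntegral.intervalIntegral_pos_of_pos_on
    ((continuous_smoothedRegularity_integrand lamA σ S).intervalIntegrable _ _) ?_ hρ.lamA_pos
  intro x hx
  refine pow_pos (sub_pos.2 (Real.exp_lt_one_iff.2 ?_)) _
  have h1 : (0 : ℝ) < σ := hρ.sigma_pos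
  have h2 : 0 < lamA - x := sub_pos.2 hx.2
  rw [neg_div]
  exact neg_neg_of_pos (by positivity)

theorem RegularActionLaw.smoothedRegularity_le (hρ : RegularActionLaw ρ lamA σ) (S : ℕ) :
    smoothedRegularity lamA σ S ≤ lamA := by
  calc smoothedRegularity lamA σ S ≤ ∫ _ in (0 : ℝ)..lamA, (1 : ℝ) := by
        refine intervalIntegral.integral_mono_on hρ.lamA_pos.le
          ((continuous_smoothedRegularity_integrand lamA σ S).intervalIntegrable _ _)
          (by simp) fun x _ => ?_
        exact pow_le_one₀ (one_sub_exp_nonneg _ _) (one_sub_exp_le_one _)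
    _ = lamA := by simp

end ActionLaw

/-! ### The worst of the candidates in a fixed direction. -/

section Candidates

variable {Ω : Type*} {mΩ : MeasurableSpace Ω} {μ : Measure Ω}
  {d k S : ℕ} [NeZero k] {ρ : Measure (Vec d)} {lamA : ℝ} {σ : ℝ≥0} {c : Fin k → Ω → Vec d}

/-- The smallest squared component in direction `x` among finitely many candidate actions. -/
def minSq (c : Fin k → Ω → Vec d) (x : Vec d) (ω : Ω) : ℝ :=
  Finset.univ.inf' Finset.univ_nonempty fun j => ⟪x, c j ω⟫ ^ 2

omit [NeZero k] in
theorem measurable_minSq_of {m : MeasurableSpace Ω} [NeZero k] (hc : ∀ j, Measurable[m] (c j))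
    (x : Vec d) : Measurable[m] (minSq c x) := by
  have : minSq c x = Finset.univ.inf' Finset.univ_nonempty fun j ω => ⟪x, c j ω⟫ ^ 2 := by
    ext ω
    simp [minSq, Finset.inf'_apply]
  rw [this]
  refine Finset.inf'_induction Finset.univ_nonempty _ (p := fun f => Measurable[m] f)
    (fun f hf g hg => Measurable.inf (m := m) hf hg) fun j _ => ?_
  have := hc j
  fun_prop

theorem minSq_nonneg (x : Vec d) (ω : Ω) : 0 ≤ minSq c x ω :=
  Finset.le_inf' _ _ fun _ _ => sq_nonneg _

theorem minSq_le (x : Vec d) (ω : Ω) (j : Fin k) : minSq c x ω ≤ ⟪x, c j ω⟫ ^ 2 :=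
  Finset.inf'_le _ (Finset.mem_univ j)

theorem minSq_le_one (hρ : RegularActionLaw ρ lamA σ) (hc : ∀ j, Measurable (c j))
    (hlaw : ∀ j, μ.map (c j) = ρ) {x : Vec d} (hx : ‖x‖ = 1) : ∀ᵐ ω ∂μ, minSq c x ω ≤ 1 := by
  have h := hρ.norm_le_one
  rw [← hlaw 0] at h
  filter_upwards [ae_of_ae_map (hc 0).aemeasurable h] with ω hω
  refine (minSq_le x ω 0).trans ?_
  rw [← sq_abs]
  refine pow_le_one₀ (abs_nonneg _) ((abs_real_inner_le_norm _ _).trans ?_)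
  rwa [hx, one_mul]

/-- The minimum exceeds `z` exactly when all `k` independent candidates do; a factor in `[0,1]` only
shrinks when `k` is raised to `S`. -/
theorem one_sub_exp_pow_le (hρ : RegularActionLaw ρ lamA σ) (hkS : k ≤ S)
    (hc : ∀ j, Measurable (c j)) (hlaw : ∀ j, μ.map (c j) = ρ) (hind : iIndepFun c μ)
    {x : Vec d} (hx : ‖x‖ = 1) {z : ℝ} (hz : z ≤ lamA) :
    ENNReal.ofReal ((1 - Real.exp (-(lamA - z) ^ 2 / (2 * (σ : ℝ) ^ 2))) ^ S)
      ≤ μ {ω | z < minSq c x ω} := by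
  have := hρ.prob
  have hA : MeasurableSet {a : Vec d | z < ⟪x, a⟫ ^ 2} :=
    measurableSet_lt measurable_const (by fun_prop)
  have hset : {ω | z < minSq c x ω} = ⋂ j ∈ Finset.univ, c j ⁻¹' {a | z < ⟪x, a⟫ ^ 2} := by
    ext ω
    simp [minSq, Finset.lt_inf'_iff]
  rw [hset, hind.measure_inter_preimage_eq_mul Finset.univ fun _ _ => hA]
  have hp : ∀ j, μ (c j ⁻¹' {a | z < ⟪x, a⟫ ^ 2}) = ρ {a | z < ⟪x, a⟫ ^ 2} := fun j => by
    rw [← hlaw j, Measure.map_apply (hc j) hA]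
  simp only [hp, Finset.prod_const, Finset.card_univ, Fintype.card_fin]
  calc _ ≤ ENNReal.ofReal ((1 - Real.exp (-(lamA - z) ^ 2 / (2 * (σ : ℝ) ^ 2))) ^ k) :=
        ENNReal.ofReal_le_ofReal
          (pow_le_pow_of_le_one (one_sub_exp_nonneg _ _) (one_sub_exp_le_one _) hkS)
    _ = ENNReal.ofReal (1 - Real.exp (-(lamA - z) ^ 2 / (2 * (σ : ℝ) ^ 2))) ^ k :=
        ENNReal.ofReal_pow (one_sub_exp_nonneg _ _) _
    _ ≤ _ := by
        gcongr
        refine (ENNReal.ofReal_le_ofReal (hρ.one_sub_exp_le hx hz)).trans ?_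
        rw [Measure.real, ENNReal.ofReal_toReal (measure_ne_top _ _)]

/-- Layer-cake formula, keeping only the levels in `(0, lamA]`. -/
theorem smoothedRegularity_le_integral_minSq [IsProbabilityMeasure μ]
    (hρ : RegularActionLaw ρ lamA σ) (hkS : k ≤ S)
    (hc : ∀ j, Measurable (c j)) (hlaw : ∀ j, μ.map (c j) = ρ) (hind : iIndepFun c μ)
    {x : Vec d} (hx : ‖x‖ = 1) : smoothedRegularity lamA σ S ≤ ∫ ω, minSq c x ω ∂μ := by
  have hmeas := measurable_minSq_of hc x
  have h0 : ∀ᵐ ω ∂μ, 0 ≤ minSq c x ω := ae_of_all _ (minSq_nonneg x)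
  have hint : Integrable (minSq c x) μ := by
    refine Integrable.of_bound (C := 1) hmeas.aestronglyMeasurable ?_
    filter_upwards [minSq_le_one hρ hc hlaw hx] with ω hω
    rwa [Real.norm_eq_abs, abs_of_nonneg (minSq_nonneg x ω)]
  refine (ENNReal.ofReal_le_ofReal_iff (integral_nonneg (minSq_nonneg x))).1 ?_
  rw [ofReal_integral_eq_lintegral_ofReal hint h0,
    lintegral_eq_lintegral_meas_lt μ h0 hmeas.aemeasurable, smoothedRegularity,
    intervalIntegral.integral_of_le hρ.lamA_pos.le, ofReal_integral_eq_lintegral_ofReal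
      ((continuous_smoothedRegularity_integrand lamA σ S).integrableOn_Ioc)
      (ae_of_all _ fun z => pow_nonneg (one_sub_exp_nonneg _ _) _)]
  calc _ ≤ ∫⁻ z in Set.Ioc 0 lamA, μ {ω | z < minSq c x ω} :=
        setLIntegral_mono' measurableSet_Ioc fun z hz =>
          one_sub_exp_pow_le hρ hkS hc hlaw hind hx hz.2
    _ ≤ _ := lintegral_mono_set Set.Ioc_subset_Ioi_self

theorem exp_neg_mul_le_one_sub {s z : ℝ} (hz0 : 0 ≤ z) (hz1 : z ≤ 1) :
    Real.exp (-(s * z)) ≤ 1 - (1 - Real.exp (-s)) * z := by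
  have h := convexOn_exp.2 (Set.mem_univ 0) (Set.mem_univ (-s)) (sub_nonneg.2 hz1) hz0
    (by ring)
  simp only [smul_eq_mul, mul_zero, zero_add, Real.exp_zero, mul_one] at h
  rw [show -(s * z) = z * -s by ring]
  linarith

/-- The chord of the convex exponential over `[0,1]` makes the bound linear in the minimum, so only
its mean is needed; then `1 - t ≤ exp(-t)`. -/
theorem lintegral_exp_neg_mul_minSq_le [IsProbabilityMeasure μ]
    (hρ : RegularActionLaw ρ lamA σ) (hkS : k ≤ S)
    (hc : ∀ j, Measurable (c j)) (hlaw : ∀ j, μ.map (c j) = ρ) (hind : iIndepFun c μ)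
    {x : Vec d} (hx : ‖x‖ = 1) {s : ℝ} (hs : 0 ≤ s) :
    ∫⁻ ω, ENNReal.ofReal (Real.exp (-(s * minSq c x ω))) ∂μ
      ≤ ENNReal.ofReal (Real.exp (-((1 - Real.exp (-s)) * smoothedRegularity lamA σ S))) := by
  have hmeas := measurable_minSq_of hc x
  have hle := minSq_le_one hρ hc hlaw hx
  have hint : Integrable (minSq c x) μ := by
    refine Integrable.of_bound (C := 1) hmeas.aestronglyMeasurable ?_
    filter_upwards [hle] with ω hω
    rwa [Real.norm_eq_abs, abs_of_nonneg (minSq_nonneg x ω)]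
  have hint' : Integrable (fun ω => 1 - (1 - Real.exp (-s)) * minSq c x ω) μ :=
    (integrable_const _).sub (hint.const_mul _)
  have hpt : ∀ᵐ ω ∂μ, Real.exp (-(s * minSq c x ω)) ≤ 1 - (1 - Real.exp (-s)) * minSq c x ω := by
    filter_upwards [hle] with ω hω
    exact exp_neg_mul_le_one_sub (minSq_nonneg x ω) hω
  calc _ ≤ ∫⁻ ω, ENNReal.ofReal (1 - (1 - Real.exp (-s)) * minSq c x ω) ∂μ :=
        lintegral_mono_ae (hpt.mono fun ω h => ENNReal.ofReal_le_ofReal h)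
    _ = ENNReal.ofReal (∫ ω, (1 - (1 - Real.exp (-s)) * minSq c x ω) ∂μ) :=
        (ofReal_integral_eq_lintegral_ofReal hint'
          (hpt.mono fun ω h => (Real.exp_pos _).le.trans h)).symm
    _ ≤ _ := by
        refine ENNReal.ofReal_le_ofReal ?_
        rw [integral_sub (integrable_const _) (hint.const_mul _), integral_const_mul]
        have h1 := smoothedRegularity_le_integral_minSq hρ hkS hc hlaw hind hx
        have h2 : 0 ≤ 1 - Real.exp (-s) := by simpa using hs
        have h3 := mul_le_mul_of_nonneg_left h1 h2
        have h4 := Real.add_one_le_exp (-((1 - Real.exp (-s)) * smoothedRegularity lamA σ S))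
        simp only [integral_const, probReal_univ, smul_eq_mul, mul_one]
        linarith

end Candidates

/-! ### The exponential process and its Gaussian mixture. -/

section SelfNormalized

variable {Ω : Type*} {mΩ : MeasurableSpace Ω} {μ : Measure Ω} {U d S : ℕ}
  {D : OfflineData Ω U d} {θ : Fin U → Vec d} {ρ : Measure (Vec d)} {lamA : ℝ} {σ : ℝ≥0}
  {past : (u : Fin U) → Filtration ℕ mΩ}

/-- The exponent `∑_{i < n} (⟨y, a_i⟩ η_i - ⟨y, a_i⟩²)`. -/
def selfNormExponent (D : OfflineData Ω U d) (θ : Fin U → Vec d) (u : Fin U) (y : Vec d) (n : ℕ)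
    (ω : Ω) : ℝ :=
  ∑ i ∈ Finset.range n,
    (⟪y, D.action u i ω⟫ * noise D θ u i ω - ⟪y, D.action u i ω⟫ ^ 2)

theorem IsOffClusBand.preReward_le (hD : IsOffClusBand μ D θ ρ S past) {u : Fin U} {i : ℕ}
    (hi : i < D.N u) : preReward D past u i ≤ past u (i + 1) :=
  sup_le (sup_le ((past u).mono i.le_succ)
    (iSup_le fun j => (hD.measurable_cand u i hi j).comap_le))
    (hD.measurable_action u i hi).comap_le

theorem IsOffClusBand.measurable_noise (hD : IsOffClusBand μ D θ ρ S past) {u : Fin U} {i : ℕ}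
    (hi : i < D.N u) : Measurable[past u (i + 1)] (noise D θ u i) := by
  have h1 := hD.measurable_action u i hi
  have h2 := hD.measurable_reward u i hi
  unfold noise
  fun_prop

theorem IsOffClusBand.measurable_selfNormExponent (hD : IsOffClusBand μ D θ ρ S past) (u : Fin U)
    (y : Vec d) {n : ℕ} (hn : n ≤ D.N u) : Measurable[past u n] (selfNormExponent D θ u y n) := by
  unfold selfNormExponent
  refine Finset.measurable_fun_sum _ fun i hi => ?_
  have hi' := Finset.mem_range.1 hi
  have hle : past u (i + 1) ≤ past u n := (past u).mono hi'
  have h1 := (hD.measurable_action u i (hi'.trans_le hn)).mono hle le_rfl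
  have h2 := (hD.measurable_noise (hi'.trans_le hn)).mono hle le_rfl
  fun_prop

variable [IsProbabilityMeasure μ]

theorem IsOffClusBand.numCand_ne_zero (hD : IsOffClusBand μ D θ ρ S past) {u : Fin U} {i : ℕ}
    (hi : i < D.N u) : D.numCand u i ≠ 0 := by
  obtain ⟨ω, j, -⟩ := (hD.action_mem u i hi).exists
  exact (Fin.pos j).ne'

/-- The new square is split in two: one half compensates the noise given `preReward`, the other is
averaged over the fresh candidates. -/
theorem IsOffClusBand.lintegral_exp_selfNormExponent_succ_le (hρ : RegularActionLaw ρ lamA σ)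
    (hD : IsOffClusBand μ D θ ρ S past) (u : Fin U) {y : Vec d} (hy : y ≠ 0) {n : ℕ}
    (hn : n < D.N u) :
    ∫⁻ ω, ENNReal.ofReal (Real.exp (selfNormExponent D θ u y (n + 1) ω)) ∂μ ≤
      (∫⁻ ω, ENNReal.ofReal (Real.exp (selfNormExponent D θ u y n ω)) ∂μ) *
        ENNReal.ofReal (Real.exp
          (-((1 - Real.exp (-(‖y‖ ^ 2 / 2))) * smoothedRegularity lamA σ S))) := by
  have : NeZero (D.numCand u n) := ⟨hD.numCand_ne_zero hn⟩
  set A : Ω → ℝ≥0∞ := fun ω => ENNReal.ofReal (Real.exp (selfNormExponent D θ u y n ω))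
  have hpast : past u n ≤ mΩ := (past u).le n
  have hpast' : past u (n + 1) ≤ mΩ := (past u).le (n + 1)
  have hpre : preReward D past u n ≤ mΩ := (hD.preReward_le hn).trans hpast'
  have hA : Measurable[past u n] A :=
    (hD.measurable_selfNormExponent u y hn.le).exp.ennreal_ofReal
  have hnoise : Measurable (noise D θ u n) := (hD.measurable_noise hn).mono hpast' le_rfl
  have haction : Measurable[preReward D past u n] (D.action u n) :=
    (comap_measurable _).mono le_sup_right le_rfl
  set T : Ω → ℝ := fun ω => ⟪y, D.action u n ω⟫
  have hT : Measurable[preReward D past u n] T := by fun_prop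
  set x : Vec d := ‖y‖⁻¹ • y
  have hx : ‖x‖ = 1 := norm_smul_inv_norm (𝕜 := ℝ) hy
  have hyx : y = ‖y‖ • x := by
    rw [smul_smul, mul_inv_cancel₀ (norm_ne_zero_iff.2 hy), one_smul]
  have hcand : ∀ j, Measurable (D.cand u n j) := fun j =>
    (hD.measurable_cand u n hn j).mono hpast' le_rfl
  set W : Ω → ℝ≥0∞ := fun ω =>
    ENNReal.ofReal (Real.exp (-(‖y‖ ^ 2 / 2 * minSq (D.cand u n) x ω)))
  have hW : Measurable[⨆ j, MeasurableSpace.comap (D.cand u n j) inferInstance] W := by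
    have := measurable_minSq_of
      (m := ⨆ j, MeasurableSpace.comap (D.cand u n j) inferInstance) (c := D.cand u n)
      (fun j => (comap_measurable (D.cand u n j)).mono
        (le_iSup (fun j => MeasurableSpace.comap (D.cand u n j) inferInstance) j) le_rfl) x
    fun_prop
  have hX : Measurable[preReward D past u n] fun ω =>
      A ω * ENNReal.ofReal (Real.exp (-(T ω ^ 2 / 2))) := by
    refine Measurable.mul (m := preReward D past u n)
      (hA.mono (le_sup_left.trans le_sup_left) le_rfl) ?_
    fun_prop
  calc ∫⁻ ω, ENNReal.ofReal (Real.exp (selfNormExponent D θ u y (n + 1) ω)) ∂μ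
      = ∫⁻ ω, A ω * ENNReal.ofReal (Real.exp (-(T ω ^ 2 / 2))) *
          ENNReal.ofReal (Real.exp (T ω * noise D θ u n ω - T ω ^ 2 / 2)) ∂μ := by
        refine lintegral_congr fun ω => ?_
        rw [← ENNReal.ofReal_mul (Real.exp_pos _).le, ← ENNReal.ofReal_mul (by positivity),
          ← Real.exp_add, ← Real.exp_add, selfNormExponent, Finset.sum_range_succ,
          ← selfNormExponent]
        congr 2
        ring
    _ ≤ ∫⁻ ω, A ω * ENNReal.ofReal (Real.exp (-(T ω ^ 2 / 2))) ∂μ :=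
        lintegral_mul_exp_measurable_le hpre hnoise (hD.integrable_exp_noise u n hn)
          (hD.noise_subgaussian u n hn) hT hX
    -- The logged action may depend on the past; the worst candidate does not, so passing to it lets
    -- the expectation factor.
    _ ≤ ∫⁻ ω, A ω * W ω ∂μ := by
        refine lintegral_mono_ae ?_
        filter_upwards [hD.action_mem u n hn] with ω ⟨j, hj⟩
        have h1 : T ω ^ 2 = ‖y‖ ^ 2 * ⟪x, D.cand u n j ω⟫ ^ 2 := by
          simp only [T]
          rw [hj, ← mul_pow, ← real_inner_smul_left, ← hyx]
        have h2 := mul_le_mul_of_nonneg_left (minSq_le (c := D.cand u n) x ω j)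
          (sq_nonneg ‖y‖)
        simp only [W]
        gcongr
        rw [h1]
        linarith
    _ = (∫⁻ ω, A ω ∂μ) * ∫⁻ ω, W ω ∂μ :=
        lintegral_mul_eq_lintegral_mul_lintegral_of_independent_measurableSpace hpast
          (iSup_le fun j => (hcand j).comap_le) (hD.cand_indep_past u n hn).symm hA hW
    _ ≤ _ := by
        gcongr
        exact lintegral_exp_neg_mul_minSq_le hρ (hD.numCand_le u n hn) hcand
          (hD.cand_law u n hn) (hD.cand_iIndep u n hn) hx (by positivity)

theorem IsOffClusBand.lintegral_exp_selfNormExponent_le (hρ : RegularActionLaw ρ lamA σ)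
    (hD : IsOffClusBand μ D θ ρ S past) (u : Fin U) (y : Vec d) {n : ℕ} (hn : n ≤ D.N u) :
    ∫⁻ ω, ENNReal.ofReal (Real.exp (selfNormExponent D θ u y n ω)) ∂μ ≤
      ENNReal.ofReal (Real.exp
        (-(n * ((1 - Real.exp (-(‖y‖ ^ 2 / 2))) * smoothedRegularity lamA σ S)))) := by
  rcases eq_or_ne y 0 with rfl | hy
  · simp [selfNormExponent]
  induction n with
  | zero => simp [selfNormExponent]
  | succ n ih =>
    refine (hD.lintegral_exp_selfNormExponent_succ_le hρ u hy hn).trans ?_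
    refine (mul_le_mul_left (ih (Nat.le_of_succ_le hn)) _).trans_eq ?_
    rw [← ENNReal.ofReal_mul (Real.exp_pos _).le, ← Real.exp_add]
    congr 2
    push_cast
    ring

/-- The self-normalized exponent, compensated so that its exponential has mean at most one, with
a Gaussian weight of precision `lam`. -/
def weightedExponent (D : OfflineData Ω U d) (θ : Fin U → Vec d) (lam lamT : ℝ) (u : Fin U)
    (y : Vec d) (ω : Ω) : ℝ :=
  selfNormExponent D θ u y (D.N u) ω + D.N u * ((1 - Real.exp (-(‖y‖ ^ 2 / 2))) * lamT)
    - lam / 2 * ‖y‖ ^ 2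

omit [IsProbabilityMeasure μ] in
theorem IsOffClusBand.measurable_weightedExponent (hD : IsOffClusBand μ D θ ρ S past)
    (lam lamT : ℝ) (u : Fin U) :
    Measurable fun p : Ω × Vec d => weightedExponent D θ lam lamT u p.2 p.1 := by
  unfold weightedExponent selfNormExponent
  have h : Measurable fun p : Ω × Vec d => ∑ i ∈ Finset.range (D.N u),
      (⟪p.2, D.action u i p.1⟫ * noise D θ u i p.1 - ⟪p.2, D.action u i p.1⟫ ^ 2) := by
    refine Finset.measurable_fun_sum _ fun i hi => ?_
    have hi' := Finset.mem_range.1 hi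
    have h1 : Measurable (D.action u i) :=
      (hD.measurable_action u i hi').mono ((past u).le _) le_rfl
    have h2 : Measurable (noise D θ u i) :=
      (hD.measurable_noise hi').mono ((past u).le _) le_rfl
    fun_prop
  fun_prop

/-- By Tonelli the compensator cancels the mean bound for each fixed `y`, and only the Gaussian
integral remains. -/
theorem IsOffClusBand.lintegral_lintegral_exp_weightedExponent_le
    (hρ : RegularActionLaw ρ lamA σ) (hD : IsOffClusBand μ D θ ρ S past) {lam : ℝ}
    (hlam : 0 < lam) (u : Fin U) :
    ∫⁻ ω, (∫⁻ y : Vec d, ENNReal.ofReal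
        (Real.exp (weightedExponent D θ lam (smoothedRegularity lamA σ S) u y ω))) ∂μ ≤
      ENNReal.ofReal ((2 * Real.pi / lam) ^ (d / 2 : ℝ)) := by
  have hmeas := hD.measurable_weightedExponent lam (smoothedRegularity lamA σ S) u
  rw [lintegral_lintegral_swap (by
    exact (hmeas.exp.ennreal_ofReal).aemeasurable)]
  have hexp : Integrable fun y : Vec d => Real.exp (-(lam / 2) * ‖y‖ ^ 2) := by
    have h := GaussianFourier.integrable_cexp_neg_mul_sq_norm_add (V := Vec d)
      (b := (lam / 2 : ℝ)) (by simpa using hlam) 0 0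
    refine h.norm.congr (ae_of_all _ fun y => ?_)
    simp only [Complex.norm_exp]
    congr 1
    simp [← Complex.ofReal_pow]
  calc _ ≤ ∫⁻ y : Vec d, ENNReal.ofReal (Real.exp (-(lam / 2) * ‖y‖ ^ 2)) := by
        refine lintegral_mono fun y => ?_
        set c := D.N u * ((1 - Real.exp (-(‖y‖ ^ 2 / 2))) * smoothedRegularity lamA σ S) with hc
        calc _ = ∫⁻ ω, ENNReal.ofReal (Real.exp (selfNormExponent D θ u y (D.N u) ω)) *
              ENNReal.ofReal (Real.exp (c - lam / 2 * ‖y‖ ^ 2)) ∂μ := by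
              refine lintegral_congr fun ω => ?_
              rw [← ENNReal.ofReal_mul (Real.exp_pos _).le, ← Real.exp_add, weightedExponent,
                add_sub_assoc]
          _ ≤ ENNReal.ofReal (Real.exp (-c)) *
              ENNReal.ofReal (Real.exp (c - lam / 2 * ‖y‖ ^ 2)) := by
              rw [lintegral_mul_const' _ _ ENNReal.ofReal_ne_top]
              gcongr
              exact hD.lintegral_exp_selfNormExponent_le hρ u y le_rfl
          _ = _ := by
              rw [← ENNReal.ofReal_mul (Real.exp_pos _).le, ← Real.exp_add]
              congr 2
              ring
    _ = _ := by
        rw [← ofReal_integral_eq_lintegral_ofReal hexp (ae_of_all _ fun y => (Real.exp_pos _).le),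
          GaussianFourier.integral_rexp_neg_mul_sq_norm (by positivity), finrank_euclideanSpace,
          Fintype.card_fin]
        congr 2
        field_simp

end SelfNormalized

theorem ofReal_integral_le_lintegral {α : Type*} {mα : MeasurableSpace α} {ν : Measure α}
    {f : α → ℝ} (hf : Integrable f ν) :
    ENNReal.ofReal (∫ x, f x ∂ν) ≤ ∫⁻ x, ENNReal.ofReal (f x) ∂ν := by
  rw [integral_eq_lintegral_pos_part_sub_lintegral_neg_part hf]
  exact (ENNReal.ofReal_le_ofReal (sub_le_self _ ENNReal.toReal_nonneg)).trans
    ENNReal.ofReal_toReal_le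

/-! ### Gaussian integrals and the Jensen lower bound. -/

section Gaussian

variable {d : ℕ}

theorem integrable_exp_neg_mul_sq_norm_add {b : ℝ} (hb : 0 < b) (w : Vec d) :
    Integrable fun v : Vec d => Real.exp (-b * ‖v‖ ^ 2 + ⟪w, v⟫) := by
  have h := GaussianFourier.integrable_cexp_neg_mul_sq_norm_add (V := Vec d)
    (b := (b : ℂ)) (by simpa using hb) 1 w
  refine h.norm.congr (ae_of_all _ fun y => ?_)
  simp only [Complex.norm_exp]
  congr 1
  simp [← Complex.ofReal_pow]

theorem integral_exp_neg_mul_sq_norm_add {b : ℝ} (hb : 0 < b) (w : Vec d) :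
    ∫ v : Vec d, Real.exp (-b * ‖v‖ ^ 2 + ⟪w, v⟫) =
      (Real.pi / b) ^ (d / 2 : ℝ) * Real.exp (‖w‖ ^ 2 / (4 * b)) := by
  have h := GaussianFourier.integral_cexp_neg_mul_sq_norm_add (V := Vec d)
    (b := (b : ℂ)) (by simpa using hb) 1 w
  rw [← Complex.ofReal_inj, ← integral_complex_ofReal]
  push_cast
  rw [Complex.ofReal_cpow (by positivity)]
  simpa using h

variable {P : ℝ} (hP : 0 < P)

include hP

theorem integrable_gaussian : Integrable fun w : Vec d => Real.exp (-(P / 2) * ‖w‖ ^ 2) := by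
  simpa using integrable_exp_neg_mul_sq_norm_add (d := d) (half_pos hP) 0

theorem integrable_sq_norm_mul_gaussian :
    Integrable fun w : Vec d => ‖w‖ ^ 2 * Real.exp (-(P / 2) * ‖w‖ ^ 2) := by
  refine ((integrable_gaussian (d := d) (half_pos hP)).const_mul (4 / P)).mono'
    (by fun_prop) (ae_of_all _ fun w => ?_)
  rw [Real.norm_of_nonneg (by positivity)]
  have h1 : ‖w‖ ^ 2 ≤ 4 / P * Real.exp (P / 4 * ‖w‖ ^ 2) := by
    have := Real.add_one_le_exp (P / 4 * ‖w‖ ^ 2)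
    calc ‖w‖ ^ 2 = 4 / P * (P / 4 * ‖w‖ ^ 2) := by field_simp
      _ ≤ _ := by gcongr; linarith
  calc _ ≤ 4 / P * Real.exp (P / 4 * ‖w‖ ^ 2) * Real.exp (-(P / 2) * ‖w‖ ^ 2) := by gcongr
    _ = _ := by
      rw [mul_assoc, ← Real.exp_add]
      congr 2
      ring

theorem integrable_inner_sq_mul_gaussian (a : Vec d) :
    Integrable fun w : Vec d => ⟪a, w⟫ ^ 2 * Real.exp (-(P / 2) * ‖w‖ ^ 2) := by
  refine ((integrable_sq_norm_mul_gaussian (d := d) hP).const_mul (‖a‖ ^ 2)).mono'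
    (by fun_prop) (ae_of_all _ fun w => ?_)
  rw [Real.norm_of_nonneg (by positivity), ← mul_assoc, ← mul_pow, ← sq_abs]
  gcongr
  exact abs_real_inner_le_norm a w

theorem integrable_inner_mul_gaussian (a : Vec d) :
    Integrable fun w : Vec d => ⟪a, w⟫ * Real.exp (-(P / 2) * ‖w‖ ^ 2) := by
  refine ((integrable_gaussian (d := d) hP).add (integrable_inner_sq_mul_gaussian hP a)).mono'
    (by fun_prop) (ae_of_all _ fun w => ?_)
  rw [norm_mul, Real.norm_of_nonneg (Real.exp_pos _).le, Pi.add_apply, ← one_add_mul,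
    Real.norm_eq_abs]
  gcongr
  rw [← sq_abs]
  nlinarith [sq_nonneg (|⟪a, w⟫| - 1)]

omit hP in
theorem integral_inner_mul_gaussian (a : Vec d) :
    ∫ w : Vec d, ⟪a, w⟫ * Real.exp (-(P / 2) * ‖w‖ ^ 2) = 0 := by
  have h := integral_neg_eq_self (fun w : Vec d => ⟪a, w⟫ * Real.exp (-(P / 2) * ‖w‖ ^ 2)) volume
  simp only [inner_neg_right, norm_neg, neg_mul, integral_neg] at h
  simp only [neg_mul]
  linarith

omit hP in
-- The reflection exchanging `x` and `y` preserves both volume and the Gaussian weight.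
theorem integral_inner_sq_mul_gaussian_congr {x y : Vec d} (hxy : ‖x‖ = ‖y‖) :
    ∫ w : Vec d, ⟪x, w⟫ ^ 2 * Real.exp (-(P / 2) * ‖w‖ ^ 2) =
      ∫ w : Vec d, ⟪y, w⟫ ^ 2 * Real.exp (-(P / 2) * ‖w‖ ^ 2) := by
  set R := (ℝ ∙ (x - y))ᗮ.reflection
  have hR : R x = y := Submodule.reflection_sub hxy
  rw [← R.measurePreserving.integral_comp R.toHomeomorph.measurableEmbedding
    (fun w : Vec d => ⟪y, w⟫ ^ 2 * Real.exp (-(P / 2) * ‖w‖ ^ 2))]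
  simp only [LinearIsometryEquiv.norm_map, ← hR, LinearIsometryEquiv.inner_map_map]

/-- By rotation invariance `a` may be replaced by `‖a‖` times any basis vector; summing over the
basis gives `‖w‖²`. -/
theorem mul_integral_inner_sq_mul_gaussian (a : Vec d) :
    d * ∫ w : Vec d, ⟪a, w⟫ ^ 2 * Real.exp (-(P / 2) * ‖w‖ ^ 2) =
      ‖a‖ ^ 2 * ∫ w : Vec d, ‖w‖ ^ 2 * Real.exp (-(P / 2) * ‖w‖ ^ 2) := by
  have hi : ∀ i : Fin d, ∫ w : Vec d, ⟪a, w⟫ ^ 2 * Real.exp (-(P / 2) * ‖w‖ ^ 2) =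
      ∫ w : Vec d, ‖a‖ ^ 2 * (w i ^ 2 * Real.exp (-(P / 2) * ‖w‖ ^ 2)) := fun i => by
    rw [integral_inner_sq_mul_gaussian_congr (y := EuclideanSpace.single i ‖a‖) (by simp)]
    refine integral_congr_ae (ae_of_all _ fun w => ?_)
    simp only [EuclideanSpace.inner_single_left, conj_trivial]
    ring
  have hint : ∀ i : Fin d, Integrable fun w : Vec d =>
      ‖a‖ ^ 2 * (w i ^ 2 * Real.exp (-(P / 2) * ‖w‖ ^ 2)) := fun i => by
    have := integrable_inner_sq_mul_gaussian hP (EuclideanSpace.single i (1 : ℝ))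
    simpa [EuclideanSpace.inner_single_left] using this.const_mul (‖a‖ ^ 2)
  calc _ = ∑ _i : Fin d, ∫ w : Vec d, ⟪a, w⟫ ^ 2 * Real.exp (-(P / 2) * ‖w‖ ^ 2) := by simp
    _ = ∑ i : Fin d, ∫ w : Vec d, ‖a‖ ^ 2 * (w i ^ 2 * Real.exp (-(P / 2) * ‖w‖ ^ 2)) :=
        Finset.sum_congr rfl fun i _ => hi i
    _ = _ := by
        rw [← integral_finsetSum _ fun i _ => hint i, ← integral_const_mul]
        refine integral_congr_ae (ae_of_all _ fun w => ?_)
        simp only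
        rw [← Finset.mul_sum, ← Finset.sum_mul, EuclideanSpace.real_norm_sq_eq w]

omit hP in
theorem integral_gaussian (hP : 0 < P) :
    ∫ w : Vec d, Real.exp (-(P / 2) * ‖w‖ ^ 2) = (2 * Real.pi / P) ^ (d / 2 : ℝ) := by
  have h := integral_exp_neg_mul_sq_norm_add (d := d) (half_pos hP) 0
  simp only [inner_zero_left, add_zero, norm_zero] at h
  rw [h]
  norm_num
  congr 1
  field_simp

theorem integrable_shifted_mul_gaussian (y : Vec d) :
    Integrable fun w : Vec d =>
      Real.exp (-(‖y + w‖ ^ 2 / 2)) * Real.exp (-(P / 2) * ‖w‖ ^ 2) := by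
  refine (integrable_gaussian hP).mono' (by fun_prop) (ae_of_all _ fun w => ?_)
  rw [Real.norm_of_nonneg (by positivity)]
  refine mul_le_of_le_one_left (Real.exp_pos _).le (Real.exp_le_one_iff.2 ?_)
  exact neg_nonpos.2 (by positivity)

/-- Smoothing by the Gaussian does not raise the bump at `y`. Completing the square costs
`exp(‖y‖²/(2(P+1)))` and gains `(P/(P+1))^(d/2)`; since `‖y‖² ≤ 1 ≤ d`, the gain wins by `1 - t ≤
exp(-t)`. -/
theorem integral_shifted_mul_gaussian_le (hd : 0 < d) {y : Vec d} (hy : ‖y‖ ≤ 1) :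
    ∫ w : Vec d, Real.exp (-(‖y + w‖ ^ 2 / 2)) * Real.exp (-(P / 2) * ‖w‖ ^ 2) ≤
      Real.exp (-(‖y‖ ^ 2 / 2)) * ∫ w : Vec d, Real.exp (-(P / 2) * ‖w‖ ^ 2) := by
  have hP1 : 0 < P + 1 := by linarith
  have h1 : ∀ w : Vec d, Real.exp (-(‖y + w‖ ^ 2 / 2)) * Real.exp (-(P / 2) * ‖w‖ ^ 2) =
      Real.exp (-(‖y‖ ^ 2 / 2)) * Real.exp (-((P + 1) / 2) * ‖w‖ ^ 2 + ⟪-y, w⟫) := fun w => by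
    rw [← Real.exp_add, ← Real.exp_add, norm_add_sq_real, inner_neg_left]
    congr 1
    ring
  simp only [h1]
  rw [integral_const_mul, integral_exp_neg_mul_sq_norm_add (half_pos hP1), integral_gaussian hP]
  gcongr
  have hd' : (0 : ℝ) < d := by exact_mod_cast hd
  have hd1 : (1 : ℝ) ≤ d := by exact_mod_cast hd
  have h2 : ‖-y‖ ^ 2 / (4 * ((P + 1) / 2)) ≤ 1 / (P + 1) * (d / 2 : ℝ) := by
    rw [norm_neg]
    have : ‖y‖ ^ 2 ≤ d := (pow_le_one₀ (norm_nonneg _) hy).trans hd1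
    calc _ = ‖y‖ ^ 2 / (2 * (P + 1)) := by congr 1; ring
      _ ≤ d / (2 * (P + 1)) := by gcongr
      _ = _ := by field_simp
  calc _ ≤ (Real.pi / ((P + 1) / 2)) ^ (d / 2 : ℝ) * Real.exp (1 / (P + 1) * (d / 2 : ℝ)) := by
        gcongr
    _ = (Real.pi / ((P + 1) / 2) * Real.exp (1 / (P + 1))) ^ (d / 2 : ℝ) := by
        rw [Real.mul_rpow (by positivity) (by positivity), ← Real.exp_mul]
    _ ≤ (2 * Real.pi / P) ^ (d / 2 : ℝ) := by
        have h3 : P / (P + 1) ≤ Real.exp (-(1 / (P + 1))) := by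
          have := Real.add_one_le_exp (-(1 / (P + 1)))
          refine le_trans (le_of_eq ?_) this
          field_simp
          ring
        rw [Real.exp_neg, le_inv_comm₀ (by positivity) (by positivity), inv_div] at h3
        gcongr
        calc _ ≤ Real.pi / ((P + 1) / 2) * ((P + 1) / P) := by gcongr
          _ = _ := by field_simp

/-- Jensen's inequality for a Gaussian weight and a quadratic exponent of nonnegative mean, minus a
Gaussian bump. -/
theorem le_lintegral_exp_quadratic (hd : 0 < d) {y : Vec d} (hy : ‖y‖ ≤ 1) {s : Finset ℕ}
    {a : ℕ → Vec d} (ha : ∀ i ∈ s, ‖a i‖ ≤ 1) {K : ℝ} (hK : 0 ≤ K) (l : Vec d) (C : ℝ) :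
    ENNReal.ofReal (Real.exp (C - K * Real.exp (-(‖y‖ ^ 2 / 2))) *
        (2 * Real.pi / P) ^ (d / 2 : ℝ)) ≤
      ∫⁻ w : Vec d, ENNReal.ofReal (Real.exp (C + ⟪l, w⟫ + ∑ i ∈ s, (‖w‖ ^ 2 / d - ⟪a i, w⟫ ^ 2)
        - K * Real.exp (-(‖y + w‖ ^ 2 / 2)) - P / 2 * ‖w‖ ^ 2)) := by
  have hd' : (0 : ℝ) < d := by exact_mod_cast hd
  set q : Vec d → ℝ := fun w => Real.exp (-(P / 2) * ‖w‖ ^ 2) with hq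
  set c := C - K * Real.exp (-(‖y‖ ^ 2 / 2)) with hc
  have hI0 : Integrable q := integrable_gaussian hP
  have hI1 : Integrable fun w => ⟪l, w⟫ * q w := integrable_inner_mul_gaussian hP l
  have hI2 : ∀ i ∈ s, Integrable fun w => ‖w‖ ^ 2 * q w / d - ⟪a i, w⟫ ^ 2 * q w := fun i _ =>
    ((integrable_sq_norm_mul_gaussian hP).div_const _).sub
      (integrable_inner_sq_mul_gaussian hP (a i))
  have hI3 : Integrable fun w : Vec d => Real.exp (-(‖y + w‖ ^ 2 / 2)) * q w :=
    integrable_shifted_mul_gaussian hP y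
  have hI2' : Integrable fun w => ∑ i ∈ s, (‖w‖ ^ 2 * q w / d - ⟪a i, w⟫ ^ 2 * q w) :=
    integrable_finsetSum _ hI2
  -- `F` is the tangent-line minorant `(G - c + 1) q` of `exp(G - c) q`. The linear term integrates
  -- to zero and the quadratic terms to something nonnegative, so its integral is at least the
  -- Gaussian mass.
  set F : Vec d → ℝ := (fun w => (1 + K * Real.exp (-(‖y‖ ^ 2 / 2))) * q w)
    + (fun w => ⟪l, w⟫ * q w) + (fun w => ∑ i ∈ s, (‖w‖ ^ 2 * q w / d - ⟪a i, w⟫ ^ 2 * q w))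
    - (fun w => K * (Real.exp (-(‖y + w‖ ^ 2 / 2)) * q w)) with hF
  have hI01 := (hI0.const_mul (1 + K * Real.exp (-(‖y‖ ^ 2 / 2)))).add hI1
  have hIF : Integrable F := (hI01.add hI2').sub (hI3.const_mul K)
  have hle : (2 * Real.pi / P) ^ (d / 2 : ℝ) ≤ ∫ w, F w := by
    rw [hF, integral_sub' (hI01.add hI2') (hI3.const_mul K), integral_add' hI01 hI2',
      integral_add' (hI0.const_mul _) hI1, integral_const_mul, integral_const_mul,
      integral_finsetSum _ hI2, integral_inner_mul_gaussian]
    have h1 : 0 ≤ ∑ i ∈ s, ∫ w, (‖w‖ ^ 2 * q w / d - ⟪a i, w⟫ ^ 2 * q w) := by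
      refine Finset.sum_nonneg fun i hi => ?_
      rw [integral_sub ((integrable_sq_norm_mul_gaussian hP).div_const _)
        (integrable_inner_sq_mul_gaussian hP (a i)), integral_div, sub_nonneg,
        le_div_iff₀' hd', mul_integral_inner_sq_mul_gaussian hP]
      refine mul_le_of_le_one_left (integral_nonneg fun w => by positivity) ?_
      exact pow_le_one₀ (norm_nonneg _) (ha i hi)
    have h2 := mul_le_mul_of_nonneg_left (integral_shifted_mul_gaussian_le hP hd hy) hK
    have h3 : ∫ w, q w = (2 * Real.pi / P) ^ (d / 2 : ℝ) := integral_gaussian hP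
    rw [← h3]
    linarith
  calc _ ≤ ENNReal.ofReal (∫ w, Real.exp c * F w) := by
        rw [integral_const_mul]
        gcongr
    _ ≤ ∫⁻ w, ENNReal.ofReal (Real.exp c * F w) := ofReal_integral_le_lintegral (hIF.const_mul _)
    _ ≤ _ := by
        refine lintegral_mono fun w => ENNReal.ofReal_le_ofReal ?_
        set G := C + ⟪l, w⟫ + ∑ i ∈ s, (‖w‖ ^ 2 / d - ⟪a i, w⟫ ^ 2)
          - K * Real.exp (-(‖y + w‖ ^ 2 / 2)) with hG
        have h1 : F w = (G - c + 1) * q w := by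
          have : ∑ i ∈ s, (‖w‖ ^ 2 * q w / d - ⟪a i, w⟫ ^ 2 * q w) =
              (∑ i ∈ s, (‖w‖ ^ 2 / d - ⟪a i, w⟫ ^ 2)) * q w := by
            rw [Finset.sum_mul]
            exact Finset.sum_congr rfl fun i _ => by ring
          simp only [hF, Pi.sub_apply, Pi.add_apply, this, hG, hc]
          ring
        have h2 := Real.add_one_le_exp (G - c)
        calc _ = Real.exp c * ((G - c + 1) * q w) := by rw [h1]
          _ ≤ Real.exp c * (Real.exp (G - c) * q w) := by
              have : 0 ≤ q w := (Real.exp_pos _).le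
              gcongr
          _ = _ := by
              rw [hq, ← Real.exp_add, ← Real.exp_add]
              congr 1
              ring

end Gaussian

/-! ### Lower bound for the mixture when the ridge estimate is bad. -/

section Estimate

variable {Ω : Type*} {U d : ℕ} (D : OfflineData Ω U d) {lam : ℝ}

theorem posDef_gram (hlam : 0 < lam) (u : Fin U) (ω : Ω) : (gram D lam u ω).PosDef := by
  refine Matrix.PosDef.add_posSemidef (Matrix.PosDef.one.smul hlam)
    (Matrix.posSemidef_sum _ fun i _ => ?_)
  simpa using Matrix.posSemidef_vecMulVec_self_star (D.action u i ω).ofLp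

theorem inner_eq_dotProduct (x y : Vec d) : ⟪x, y⟫ = x.ofLp ⬝ᵥ y.ofLp := by
  rw [EuclideanSpace.inner_eq_star_dotProduct, star_trivial, dotProduct_comm]

/-- The normal equations of the ridge estimate. -/
theorem normal_equation (hlam : 0 < lam) (u : Fin U) (ω : Ω) (y : Vec d) :
    lam * ⟪y, ridge D lam u ω⟫ + ∑ i ∈ Finset.range (D.N u),
        ⟪y, D.action u i ω⟫ * ⟪D.action u i ω, ridge D lam u ω⟫ =
      ∑ i ∈ Finset.range (D.N u), D.reward u i ω * ⟪y, D.action u i ω⟫ := by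
  have hdet : IsUnit (gram D lam u ω).det :=
    (Matrix.isUnit_iff_isUnit_det _).1 (posDef_gram D hlam u ω).isUnit
  have h : (gram D lam u ω).mulVec (ridge D lam u ω).ofLp = (moment D u ω).ofLp := by
    rw [ridge, Matrix.mulVec_mulVec, Matrix.mul_nonsing_inv _ hdet, Matrix.one_mulVec]
  have h1 : y.ofLp ⬝ᵥ (gram D lam u ω).mulVec (ridge D lam u ω).ofLp = ⟪y, moment D u ω⟫ := by
    rw [h, inner_eq_dotProduct]
  rw [moment, inner_sum] at h1
  simp only [real_inner_smul_right] at h1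
  rw [← h1, gram, Matrix.add_mulVec, dotProduct_add, Matrix.smul_mulVec, Matrix.one_mulVec,
    dotProduct_smul, smul_eq_mul, inner_eq_dotProduct, Matrix.sum_mulVec, dotProduct_sum]
  congr 1
  refine Finset.sum_congr rfl fun i _ => ?_
  rw [inner_eq_dotProduct, inner_eq_dotProduct, Matrix.vecMulVec_mulVec]
  simp [mul_comm]

variable {D} {θ : Fin U → Vec d}

theorem noise_eq (u : Fin U) (i : ℕ) (ω : Ω) :
    noise D θ u i ω = D.reward u i ω - ⟪θ u, D.action u i ω⟫ := rfl

/-- With `e` the estimation error, the normal equations turn `∑ ⟨e,a_i⟩η_i` into `∑ ⟨e,a_i⟩² + lam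
⟨e, θ̂⟩`. At `τ • e` the squares then have coefficient `τ(1 - τ) ≥ 0`, and only the regularization
term is left. -/
theorem le_selfNormExponent (hlam : 0 < lam) {u : Fin U} (hθ : ‖θ u‖ ≤ 1) {ω : Ω} {τ : ℝ}
    (hτ0 : 0 ≤ τ) (hτ1 : τ ≤ 1) :
    lam * (τ * ‖ridge D lam u ω - θ u‖) * (‖ridge D lam u ω - θ u‖ - 1) ≤
      selfNormExponent D θ u (τ • (ridge D lam u ω - θ u)) (D.N u) ω := by
  set e := ridge D lam u ω - θ u with he
  have hr : ridge D lam u ω = e + θ u := by rw [he]; abel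
  have h := normal_equation D hlam u ω e
  have hsum : selfNormExponent D θ u (τ • e) (D.N u) ω =
      τ * (1 - τ) * ∑ i ∈ Finset.range (D.N u), ⟪e, D.action u i ω⟫ ^ 2
        + τ * (lam * ⟪e, ridge D lam u ω⟫) := by
    rw [eq_sub_of_add_eq h, selfNormExponent, ← Finset.sum_sub_distrib,
      Finset.mul_sum, Finset.mul_sum, ← Finset.sum_add_distrib]
    refine Finset.sum_congr rfl fun i _ => ?_
    rw [noise_eq, hr, inner_add_right, real_inner_smul_left, real_inner_comm e (D.action u i ω),
      real_inner_comm (θ u) (D.action u i ω)]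
    ring
  rw [hsum]
  have h1 : 0 ≤ τ * (1 - τ) * ∑ i ∈ Finset.range (D.N u), ⟪e, D.action u i ω⟫ ^ 2 :=
    mul_nonneg (mul_nonneg hτ0 (sub_nonneg.2 hτ1)) (Finset.sum_nonneg fun i _ => sq_nonneg _)
  have h2 : ‖e‖ * (‖e‖ - 1) ≤ ⟪e, ridge D lam u ω⟫ := by
    rw [hr, inner_add_right, real_inner_self_eq_norm_sq]
    have := neg_le_of_abs_le (abs_real_inner_le_norm e (θ u))
    have := mul_le_of_le_one_right (norm_nonneg e) hθ
    nlinarith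
  have h3 := mul_le_mul_of_nonneg_left h2 (mul_nonneg hτ0 hlam.le)
  linarith

/-- Chord bound on `[0,1]` with `exp(-1/2) ≤ 5/8`. -/
theorem le_one_sub_exp_neg {t : ℝ} (h0 : 0 ≤ t) (h1 : t ≤ 1) :
    3 / 8 * t ≤ 1 - Real.exp (-(t / 2)) := by
  have h := exp_neg_mul_le_one_sub (s := 1 / 2) h0 h1
  have h2 : Real.exp (-(1 / 2)) ≤ 5 / 8 := by
    have h3 : (8 / 5 : ℝ) ≤ Real.exp (1 / 2) := by
      have := Real.quadratic_le_exp_of_nonneg (x := 1 / 2) (by norm_num)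
      norm_num at this ⊢
      linarith
    rw [Real.exp_neg]
    calc (Real.exp (1 / 2))⁻¹ ≤ (8 / 5 : ℝ)⁻¹ := by gcongr
      _ = 5 / 8 := by norm_num
  rw [show 1 / 2 * t = t / 2 by ring] at h
  nlinarith

/-- Bounds the volume loss from precision `lam` to `P`. The factor `3/4` is what `3/8 * K * r²`
supplies when `K * r² / 2` is the squared numerator of the width. -/
theorem one_add_two_mul_rpow_le {x : ℝ} (hx : 2 ≤ x) (d : ℕ) :
    (1 + 2 * x) ^ (d / 2 : ℝ) ≤ Real.exp (3 / 4 * (d * Real.log (1 + x))) := by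
  have h1 : 2 * Real.log (1 + 2 * x) ≤ 3 * Real.log (1 + x) := by
    have h : (1 + 2 * x) ^ 2 ≤ (1 + x) ^ 3 := by 
      nlinarith [mul_nonneg (sq_nonneg x) (sub_nonneg.2 hx)]
    have := Real.log_le_log (by positivity) h
    rw [Real.log_pow, Real.log_pow] at this
    exact_mod_cast this
  rw [Real.rpow_def_of_pos (by linarith)]
  refine Real.exp_le_exp.2 ?_
  have : (0 : ℝ) ≤ d := d.cast_nonneg
  nlinarith

/-- Adding and subtracting `‖w‖²/d` per sample makes the quadratic part nonnegative on Gaussian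
average when `‖a_i‖ ≤ 1`; the price is the larger precision `2N/d + lam`. -/
theorem weightedExponent_add (lam lamT : ℝ) (hd : 0 < d) (u : Fin U) (y w : Vec d) (ω : Ω) :
    weightedExponent D θ lam lamT u (y + w) ω =
      (selfNormExponent D θ u y (D.N u) ω + D.N u * lamT - lam / 2 * ‖y‖ ^ 2)
        + ⟪∑ i ∈ Finset.range (D.N u),
            (noise D θ u i ω - 2 * ⟪y, D.action u i ω⟫) • D.action u i ω - lam • y, w⟫
        + ∑ i ∈ Finset.range (D.N u), (‖w‖ ^ 2 / d - ⟪D.action u i ω, w⟫ ^ 2)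
        - D.N u * lamT * Real.exp (-(‖y + w‖ ^ 2 / 2))
        - (2 * (D.N u / d) + lam) / 2 * ‖w‖ ^ 2 := by
  have hd' : (d : ℝ) ≠ 0 := by exact_mod_cast hd.ne'
  have h1 : selfNormExponent D θ u (y + w) (D.N u) ω = selfNormExponent D θ u y (D.N u) ω
      + ∑ i ∈ Finset.range (D.N u),
          (noise D θ u i ω - 2 * ⟪y, D.action u i ω⟫) * ⟪D.action u i ω, w⟫
      - ∑ i ∈ Finset.range (D.N u), ⟪D.action u i ω, w⟫ ^ 2 := by
    simp only [selfNormExponent]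
    rw [← Finset.sum_add_distrib, ← Finset.sum_sub_distrib]
    refine Finset.sum_congr rfl fun i _ => ?_
    rw [inner_add_left, real_inner_comm w]
    ring
  rw [weightedExponent, h1, inner_sub_left, sum_inner, Finset.sum_sub_distrib,
    Finset.sum_const, Finset.card_range]
  simp only [real_inner_smul_left]
  rw [nsmul_eq_mul]
  have h2 : lam / 2 * ‖y + w‖ ^ 2 =
      lam / 2 * ‖y‖ ^ 2 + lam * ⟪y, w⟫ + lam / 2 * ‖w‖ ^ 2 := by
    rw [norm_add_sq_real]
    ring
  rw [h2]
  ring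

/-- When the ridge estimate misses its confidence ball, the Gaussian mixture is large. -/
theorem le_lintegral_exp_weightedExponent (hd : 0 < d) (hlam : 0 < lam) {lamT δ : ℝ}
    (hT0 : 0 < lamT) (hT1 : d * lamT ≤ 1) (hδ : 0 < δ) {u : Fin U} (hUδ : δ ≤ 2 * U)
    (hN : 0 < D.N u) (hθ : ‖θ u‖ ≤ 1) (hCI : confWidth D lam lamT δ u ≤ 1) {ω : Ω}
    (ha : ∀ i < D.N u, ‖D.action u i ω‖ ≤ 1)
    (hbad : confWidth D lam lamT δ u < ‖ridge D lam u ω - θ u‖) :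
    ENNReal.ofReal (2 * U / δ) * ENNReal.ofReal ((2 * Real.pi / lam) ^ (d / 2 : ℝ)) ≤
      ∫⁻ y : Vec d, ENNReal.ofReal (Real.exp (weightedExponent D θ lam lamT u y ω)) := by
  have hd' : (0 : ℝ) < d := by exact_mod_cast hd
  have hN' : (0 : ℝ) < D.N u := by exact_mod_cast hN
  have hUδ' : 1 ≤ 2 * U / δ := by rwa [le_div_iff₀ hδ, one_mul]
  set e := ridge D lam u ω - θ u with he
  set r := confWidth D lam lamT δ u with hr
  set x : ℝ := D.N u / (lam * d) with hx
  have hx0 : 0 < x := by positivity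
  set L := Real.log (2 * U / δ) with hL
  have hL0 : 0 ≤ L := Real.log_nonneg hUδ'
  have hl0 : 0 ≤ Real.log (1 + x) := Real.log_nonneg (by linarith)
  set B := d * Real.log (1 + x) + 2 * L with hB
  have hB0 : 0 ≤ B := by positivity
  set K := D.N u * lamT with hK
  have hK0 : 0 < K := by positivity
  have hb : B + lam ≤ (√B + √lam) ^ 2 := by
    have h1 := Real.sq_sqrt hB0
    have h2 := Real.sq_sqrt hlam.le
    have h3 := mul_nonneg (Real.sqrt_nonneg B) (Real.sqrt_nonneg lam)
    nlinarith
  have hr0 : 0 < r := by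
    have : 0 < √lam := Real.sqrt_pos.2 hlam
    have : 0 ≤ √B := Real.sqrt_nonneg _
    refine div_pos (by positivity) (Real.sqrt_pos.2 (by positivity))
  have hr2 : K * r ^ 2 / 2 = (√B + √lam) ^ 2 := by
    have h : r = (√B + √lam) / √(lamT * D.N u / 2) := rfl
    rw [h, mul_comm lamT, ← hK, div_pow, Real.sq_sqrt (by positivity)]
    field_simp
  have hrsq : r ^ 2 ≤ 1 := pow_le_one₀ hr0.le hCI
  -- A width at most 1 forces many samples: `lam ≤ K * r² / 2 ≤ K / 2`, while `K ≤ N / d`.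
  have hx2 : 2 ≤ x := by
    have h1 : lam ≤ K / 2 := by nlinarith
    rw [hx, le_div_iff₀ (by positivity)]
    nlinarith
  -- The error is scaled back to norm exactly `r ≤ 1`, where the chord bound is available.
  set τ := r / ‖e‖ with hτ
  have he0 : 0 < ‖e‖ := hr0.trans hbad
  have hτ0 : 0 ≤ τ := by positivity
  have hτ1 : τ ≤ 1 := (div_le_one he0).2 hbad.le
  have hτe : τ * ‖e‖ = r := div_mul_cancel₀ _ he0.ne'
  set y := τ • e with hy
  have hyn : ‖y‖ = r := by rw [hy, norm_smul, Real.norm_of_nonneg hτ0, hτe]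
  have hself := le_selfNormExponent (D := D) (ω := ω) hlam hθ hτ0 hτ1
  rw [← he, hτe, ← hy] at hself
  set P := 2 * (D.N u / d) + lam with hP
  have hP0 : 0 < P := by positivity
  have hPx : P = lam * (1 + 2 * x) := by
    rw [hP, hx]
    field_simp
    ring
  set C := selfNormExponent D θ u y (D.N u) ω + K - lam / 2 * ‖y‖ ^ 2 with hC
  -- The compensator contributes at least `3/4 * (B + lam)`; the remaining terms, at least `lam *
  -- (r² / 2 - r)`, are absorbed by `3/4 * lam` through `(r - 1)² ≥ 0`.
  have hmain : 3 / 4 * (d * Real.log (1 + x)) + L ≤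
      C - K * Real.exp (-(‖y‖ ^ 2 / 2)) := by
    have h1 := mul_le_mul_of_nonneg_left (le_one_sub_exp_neg (sq_nonneg r) hrsq) hK0.le
    have h2 : lam * r * (r - 1) ≤ lam * r * (‖e‖ - 1) := by gcongr
    have h3 : 0 ≤ lam * (r - 1) ^ 2 := by positivity
    rw [hC, hyn]
    nlinarith
  calc _ = ENNReal.ofReal (Real.exp L * (2 * Real.pi / lam) ^ (d / 2 : ℝ)) := by
        rw [← ENNReal.ofReal_mul (by positivity), hL, Real.exp_log (by positivity)]
    _ ≤ ENNReal.ofReal (Real.exp (C - K * Real.exp (-(‖y‖ ^ 2 / 2))) *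
          (2 * Real.pi / P) ^ (d / 2 : ℝ)) := by
        refine ENNReal.ofReal_le_ofReal ?_
        have h1 : (2 * Real.pi / lam) ^ (d / 2 : ℝ) =
            (1 + 2 * x) ^ (d / 2 : ℝ) * (2 * Real.pi / P) ^ (d / 2 : ℝ) := by
          rw [← Real.mul_rpow (by positivity) (by positivity), hPx]
          congr 1
          field_simp
        rw [h1, ← mul_assoc]
        gcongr
        calc _ ≤ Real.exp L * Real.exp (3 / 4 * (d * Real.log (1 + x))) := by
              gcongr
              exact one_add_two_mul_rpow_le hx2 d
          _ ≤ _ := by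
              rw [← Real.exp_add]
              exact Real.exp_le_exp.2 (by linarith)
    _ ≤ _ := le_lintegral_exp_quadratic hP0 hd (hyn.trans_le hCI)
          (s := Finset.range (D.N u)) (a := fun i => D.action u i ω)
          (fun i hi => ha i (Finset.mem_range.1 hi)) hK0.le
          (∑ i ∈ Finset.range (D.N u),
            (noise D θ u i ω - 2 * ⟪y, D.action u i ω⟫) • D.action u i ω - lam • y) C
    _ = ∫⁻ w : Vec d,
          ENNReal.ofReal (Real.exp (weightedExponent D θ lam lamT u (y + w) ω)) := by
        refine lintegral_congr fun w => ?_
        rw [weightedExponent_add lam lamT hd u y w ω]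
    -- Translation invariance recentres the mixture at `y`.
    _ = _ := lintegral_add_left_eq_self
          (fun w => ENNReal.ofReal (Real.exp (weightedExponent D θ lam lamT u w ω))) y

end Estimate

/-! ### Validity of the confidence ball. -/

section Probability

variable {Ω : Type*} {mΩ : MeasurableSpace Ω} {μ : Measure Ω} [IsProbabilityMeasure μ]
  {U d S : ℕ} {D : OfflineData Ω U d} {θ : Fin U → Vec d} {ρ : Measure (Vec d)} {lamA : ℝ}
  {σ : ℝ≥0} {past : (u : Fin U) → Filtration ℕ mΩ}

omit [IsProbabilityMeasure μ] in
theorem IsOffClusBand.norm_action_le_one (hρ : RegularActionLaw ρ lamA σ)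
    (hD : IsOffClusBand μ D θ ρ S past) (u : Fin U) :
    ∀ᵐ ω ∂μ, ∀ i < D.N u, ‖D.action u i ω‖ ≤ 1 := by
  refine ae_all_iff.2 fun i => ?_
  by_cases hi : i < D.N u
  · have hc : ∀ᵐ ω ∂μ, ∀ j, ‖D.cand u i j ω‖ ≤ 1 := by
      refine ae_all_iff.2 fun j => ?_
      have h := hρ.norm_le_one
      rw [← hD.cand_law u i hi j] at h
      exact ae_of_ae_map
        ((hD.measurable_cand u i hi j).mono ((past u).le _) le_rfl).aemeasurable h
    filter_upwards [hc, hD.action_mem u i hi] with ω h1 ⟨j, hj⟩ _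
    rw [hj]
    exact h1 j
  · exact ae_of_all _ fun ω h => absurd h hi

/-- A confidence width of at most one is valid for the ridge estimate. -/
theorem IsOffClusBand.measure_confWidth_lt_le (hρ : RegularActionLaw ρ lamA σ)
    (hD : IsOffClusBand μ D θ ρ S past) (hd : 0 < d) {lam δ : ℝ} (hlam : 0 < lam) (hδ : 0 < δ)
    {u : Fin U} (hUδ : δ ≤ 2 * U) (hN : 0 < D.N u) (hθ : ‖θ u‖ ≤ 1) :
    μ {ω | confWidth D lam (smoothedRegularity lamA σ S) δ u ≤ 1 ∧
        confWidth D lam (smoothedRegularity lamA σ S) δ u < ‖ridge D lam u ω - θ u‖} ≤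
      ENNReal.ofReal (δ / (2 * U)) := by
  -- The width is deterministic, so the event is empty when it exceeds 1.
  by_cases hCI : confWidth D lam (smoothedRegularity lamA σ S) δ u ≤ 1
  swap
  · simp [hCI]
  have hT1 : d * smoothedRegularity lamA σ S ≤ 1 :=
    (mul_le_mul_of_nonneg_left (hρ.smoothedRegularity_le S) d.cast_nonneg).trans hρ.mul_le_one
  have hU : (0 : ℝ) < 2 * U := hδ.trans_le hUδ
  set g := ENNReal.ofReal ((2 * Real.pi / lam) ^ (d / 2 : ℝ)) with hg
  have hg0 : g ≠ 0 := by
    rw [hg, Ne, ENNReal.ofReal_eq_zero, not_le]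
    positivity
  have hL0 : ENNReal.ofReal (2 * U / δ) ≠ 0 := by
    rw [Ne, ENNReal.ofReal_eq_zero, not_le]
    positivity
  have hmeas := hD.measurable_weightedExponent lam (smoothedRegularity lamA σ S) u
  set M : Ω → ℝ≥0∞ := fun ω => ∫⁻ y : Vec d, ENNReal.ofReal
    (Real.exp (weightedExponent D θ lam (smoothedRegularity lamA σ S) u y ω)) with hM
  have hMm : Measurable M := (hmeas.exp.ennreal_ofReal).lintegral_prod_right'
  calc _ ≤ μ {ω | ENNReal.ofReal (2 * U / δ) * g ≤ M ω} := by
        refine measure_mono_ae ?_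
        filter_upwards [hD.norm_action_le_one hρ u] with ω ha hω
        exact le_lintegral_exp_weightedExponent hd hlam (hρ.smoothedRegularity_pos S) hT1 hδ hUδ
          hN hθ hCI ha hω.2
    _ ≤ (∫⁻ ω, M ω ∂μ) / (ENNReal.ofReal (2 * U / δ) * g) :=
        meas_ge_le_lintegral_div hMm.aemeasurable (mul_ne_zero hL0 hg0)
          (ENNReal.mul_ne_top ENNReal.ofReal_ne_top ENNReal.ofReal_ne_top)
    _ ≤ g / (ENNReal.ofReal (2 * U / δ) * g) := by
        gcongr
        exact hD.lintegral_lintegral_exp_weightedExponent_le hρ hlam u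
    _ = ENNReal.ofReal (δ / (2 * U)) := by
        rw [hg, ← ENNReal.ofReal_mul (by positivity), ← ENNReal.ofReal_div_of_pos (by positivity)]
        congr 1
        field_simp

end Probability

/-! ### From confidence balls to the overestimation policy. -/

section Policy

variable {Ω : Type*} {U d : ℕ} {D : OfflineData Ω U d} {θ : Fin U → Vec d}

/-- The two gap inequalities give `2α(CI_u + CI_v) < γ ≤ 2`, so both widths are below 1. If both
balls held, equal preferences would contradict `hlow` and distinct ones `hup`. -/
theorem exists_confWidth_lt {lam lamT δ α γ : ℝ} (hα : 1 ≤ α)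
    (hCI : ∀ u, 0 ≤ confWidth D lam lamT δ u)
    (hgap : ∀ u v, θ u ≠ θ v → γ ≤ ‖θ u - θ v‖) (hγ : γ ≤ 2) {u v : Fin U} {ω : Ω}
    (hlow : 0 < lowerGap D lam lamT δ α u v ω) (hup : upperGap D lam lamT δ α u v ω < γ) :
    ∃ w, confWidth D lam lamT δ w ≤ 1 ∧
      confWidth D lam lamT δ w < ‖ridge D lam w ω - θ w‖ := by
  unfold lowerGap at hlow
  unfold upperGap at hup
  have hu := hCI u
  have hv := hCI v
  have hαc : confWidth D lam lamT δ u + confWidth D lam lamT δ v ≤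
      α * (confWidth D lam lamT δ u + confWidth D lam lamT δ v) :=
    le_mul_of_one_le_left (add_nonneg hu hv) hα
  by_contra! hcon
  have h1 := hcon u (by linarith)
  have h2 := hcon v (by linarith)
  have htri : ridge D lam u ω - ridge D lam v ω =
      (ridge D lam u ω - θ u) - (ridge D lam v ω - θ v) + (θ u - θ v) := by abel
  by_cases huv : θ u = θ v
  · have h3 := norm_sub_le (ridge D lam u ω - θ u) (ridge D lam v ω - θ v)
    rw [htri, huv, sub_self, add_zero] at hlow
    rw [huv] at h3 h1
    linarith
  · have h3 := hgap u v huv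
    have h4 : θ u - θ v = (ridge D lam u ω - ridge D lam v ω) -
        ((ridge D lam u ω - θ u) - (ridge D lam v ω - θ v)) := by abel
    have h5 := norm_sub_le (ridge D lam u ω - ridge D lam v ω)
        ((ridge D lam u ω - θ u) - (ridge D lam v ω - θ v))
    have h6 := norm_sub_le (ridge D lam u ω - θ u) (ridge D lam v ω - θ v)
    rw [← h4] at h5
    linarith

end Policy

end OffClusBand

end

theorem mainTheorem8 {Ω : Type*} {mΩ : MeasurableSpace Ω} (μ : Measure Ω) [IsProbabilityMeasure μ]
    {U d J S : ℕ}
    -- users, clusters and preference vectors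
    (θ : Fin U → OffClusBand.Vec d) (cluster : Fin U → Fin J)
    (hcluster : ∀ u v, θ u = θ v ↔ cluster u = cluster v)
    (hθ : ∀ u, ‖θ u‖ ≤ 1)
    -- heterogeneity gap
    (hJ : ∃ u v, cluster u ≠ cluster v)
    (γ : ℝ) (hγ : 0 < γ) (hgap : ∀ u v, cluster u ≠ cluster v → γ ≤ ‖θ u - θ v‖)
    -- action regularity and the offline data
    (ρ : Measure (OffClusBand.Vec d)) (lamA : ℝ) (σ : ℝ≥0)
    (hρ : OffClusBand.RegularActionLaw ρ lamA σ)
    (D : OffClusBand.OfflineData Ω U d) (past : (u : Fin U) → Filtration ℕ mΩ)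
    (hD : OffClusBand.IsOffClusBand μ D θ ρ S past)
    (hN : ∀ u, 0 < D.N u)
    -- parameters of the algorithm
    (α lam δ : ℝ) (hα : 1 ≤ α) (hlam : 0 < lam) (hδ : 0 < δ)
    (utest : Fin U) :
    1 - 3 / 2 * δ ≤ μ.real {ω |
      (OffClusBand.certified D lam (OffClusBand.smoothedRegularity lamA σ S) δ α utest ω).Nonempty →
        γ ≤ OffClusBand.gammaHatOver D lam (OffClusBand.smoothedRegularity lamA σ S) δ α
          utest ω} := by
  set lamT := OffClusBand.smoothedRegularity lamA σ S
  set G : Set Ω := {ω | (OffClusBand.certified D lam lamT δ α utest ω).Nonempty →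
    γ ≤ OffClusBand.gammaHatOver D lam lamT δ α utest ω} with hG
  rcases le_or_gt (2 / 3) δ with hδ1 | hδ1
  · exact le_trans (by linarith) measureReal_nonneg
  have hU : (1 : ℝ) ≤ U := by exact_mod_cast Fin.pos utest
  -- In dimension zero all preference vectors coincide, contradicting the existence of two clusters.
  have hd : 0 < d := by
    obtain ⟨u, v, huv⟩ := hJ
    refine Nat.pos_of_ne_zero fun h => huv ((hcluster u v).1 ?_)
    subst h
    exact Subsingleton.elim _ _
  have hγ2 : γ ≤ 2 := by
    obtain ⟨u, v, huv⟩ := hJ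
    linarith [hgap u v huv, norm_sub_le (θ u) (θ v), hθ u, hθ v]
  have hCI : ∀ u, 0 ≤ OffClusBand.confWidth D lam lamT δ u := fun u =>
    div_nonneg (add_nonneg (Real.sqrt_nonneg _) (Real.sqrt_nonneg _)) (Real.sqrt_nonneg _)
  set E : Fin U → Set Ω := fun u => {ω | OffClusBand.confWidth D lam lamT δ u ≤ 1 ∧
    OffClusBand.confWidth D lam lamT δ u < ‖OffClusBand.ridge D lam u ω - θ u‖}
  have hsub : Gᶜ ⊆ ⋃ u, E u := by
    intro ω hω
    simp only [hG, Set.mem_compl_iff, Set.mem_ofPred_eq, Classical.not_imp, not_le] at hω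
    obtain ⟨hne, hlt⟩ := hω
    rw [OffClusBand.gammaHatOver, dif_pos hne, Finset.inf'_lt_iff] at hlt
    obtain ⟨v, hv, hlt⟩ := hlt
    simp only [OffClusBand.certified, Finset.mem_filter] at hv
    obtain ⟨w, hw⟩ := OffClusBand.exists_confWidth_lt hα hCI
      (fun u v huv => hgap u v fun h => huv ((hcluster u v).2 h)) hγ2 hv.2.2 hlt
    exact Set.mem_iUnion.2 ⟨w, hw⟩
  have hE : ∀ u, μ.real (E u) ≤ δ / (2 * U) := fun u =>
    ENNReal.toReal_le_of_le_ofReal (by positivity)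
      (hD.measure_confWidth_lt_le hρ hd hlam hδ (by linarith) (hN u) (hθ u))
  -- The union bound gives failure probability `δ/2`, stronger than the `3δ/2` required.
  have hcompl : μ.real Gᶜ ≤ δ / 2 := by
    calc μ.real Gᶜ ≤ μ.real (⋃ u, E u) := measureReal_mono hsub
      _ ≤ ∑ u, μ.real (E u) := measureReal_iUnion_fintype_le _
      _ ≤ ∑ _u : Fin U, δ / (2 * U) := Finset.sum_le_sum fun u _ => hE u
      _ = δ / 2 := by
        rw [Finset.sum_const, Finset.card_univ, Fintype.card_fin, nsmul_eq_mul]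
        field_simp
  have htot : 1 ≤ μ.real G + μ.real Gᶜ := by
    have := measureReal_union_le (μ := μ) G Gᶜ
    rwa [Set.union_compl_self, probReal_univ] at this
  linarith
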